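/- **Setting.** Let $d\ge 1$, $\mathbb N=\{1,2,\dots\}$, $\langle r\rangle=\{1,\dots,r\}$. For $\mathbf m\in\mathbb N^d$ let $\langle\mathbf m\rangle=\langle m_1\rangle\times\cdots\times\langle m_d\rangle$ and $\mathrm{vol}(\mathbf m)=m_1\cdots m_d$; $\mathbf m\to\infty$ means that every coordinate tends to infinity. Let $\Gamma=(\Gamma_1,\dots,\Gamma_d)$ be digraphs on the set of colors $\langle n\rangle$ (loops allowed). A coloring $\phi$ of $\mathbb Z^d$ or of a box $\langle\mathbf m\rangle$ is *$\Gamma$-allowed* if $(\phi(\mathbf x),\phi(\mathbf x+\mathbf e_k))\in\Gamma_k$ whenever $\mathbf x$ and $\mathbf x+\mathbf e_k$ lie in its domain. Let $C_\Gamma(\langle\mathbf m\rangle)$ be the set of $\Gamma$-allowed colorings of $\langle\mathbf m\rangle$, and assume that $\mathbb Z^d$ has a $\Gamma$-allowed coloring. For $\phi\in C_\Gamma(\langle\mathbf m\rangle)$ let $c(\phi)\in\mathbb Z_{\ge0}^n$ count the sites of each color, and let $C_\Gamma(\langle\mathbf m\rangle,\mathbf c)=\{\phi\in C_\Gamma(\langle\mathbf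 m\rangle):c(\phi)=\mathbf c\}$. - The *pressure* is $P_\Gamma(\mathbf u)=\lim_{\mathbf m\to\infty}\frac{1}{\mathrm{vol}(\mathbf m)}\log\sum_{\phi\in C_\Gamma(\langle\mathbf m\rangle)}e^{c(\phi)^{T}\mathbf u}$ for $\mathbf u\in\mathbb R^n$ (the limit exists and is finite). Its conjugate is $P_\Gamma^*(\mathbf p)=\sup_{\mathbf u\in\mathbb R^n}\left(\mathbf p^T\mathbf u-P_\Gamma(\mathbf u)\right)\in(-\infty,\infty]$, with $\mathrm{dom}\,P_\Gamma^*=\{\mathbf p\in\mathbb R^n: P_\Gamma^*(\mathbf p)<\infty\}$, and its subdifferential is $\partial P_\Gamma(\mathbf u)=\{\mathbf y\in\mathbb R^n: P_\Gamma(\mathbf z)\ge P_\Gamma(\mathbf u)+\mathbf y^T(\mathbf z-\mathbf u)\text{ for all }\mathbf z\in\mathbb R^n\}$. - $\Pi_\Gamma$ is the set of probability vectors $\mathbf p\in\mathbb R^n$ for which there are $\mathbf m_q\to\infty$ and $\mathbf c_q$ with $C_\Gamma(\langle\mathbf m_q\rangle,\mathbf c_q)\neq\emptyset$ for all $q$ and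 $\mathbf c_q/\mathrm{vol}(\mathbf m_q)\to\mathbf p$. For $\mathbf p\in\Pi_\Gamma$, the *density entropy* $h_\Gamma(\mathbf p)$ is the supremum of $\limsup_{q\to\infty}\frac{\log\#C_\Gamma(\langle\mathbf m_q\rangle,\mathbf c_q)}{\mathrm{vol}(\mathbf m_q)}$ over all such sequences. - $\Pi_\Gamma(\mathbf u)$ is the set of points of $\Pi_\Gamma$ at which $\mathbf p\mapsto\mathbf p^T\mathbf u+h_\Gamma(\mathbf p)$ attains its maximum over $\Pi_\Gamma$. - A family $\mathcal F=(\widetilde C(\langle\mathbf m\rangle))_{\mathbf m\in\mathbb N^d}$ with $\widetilde C(\langle\mathbf m\rangle)\subseteq C_\Gamma(\langle\mathbf m\rangle)$ is *friendly* if, whenever a shifted box $\langle\mathbf k\rangle+\mathbf i$ is the disjoint union of $\langle\mathbf m\rangle$ and a shifted box $\langle\mathbf l\rangle+\mathbf j$, coloring $\langle\mathbf m\rangle$ by a member of $\widetilde C(\langle\mathbf m\rangle)$ and $\langle\mathbf l\rangle+\mathbf j$ by a (shifted) member of $\widetilde C(\langle\mathbf l\rangle)$ gives a coloring which, shifted back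 to $\langle\mathbf k\rangle$, belongs to $\widetilde C(\langle\mathbf k\rangle)$. $\Gamma$ is *friendly* if there are a friendly family and a constant vector $\mathbf b\in\mathbb N^d$ such that for all $\mathbf m\in\mathbb N^d$ and $\alpha\in C_\Gamma(\langle\mathbf m\rangle)$ some member of $\widetilde C(\langle\mathbf m+2\mathbf b\rangle)$ colors $\langle\mathbf m\rangle+\mathbf b$ by (the shift of) $\alpha$. **Theorem 4.7.** Let $\Gamma$ be friendly. Then (a) $\Pi_\Gamma$ is convex, and $\Pi_\Gamma=\mathrm{dom}\,P_\Gamma^*$. (b) $h_\Gamma:\Pi_\Gamma\to\mathbb R_+$ is concave. (c) For each $\mathbf u\in\mathbb R^n$, $\Pi_\Gamma(\mathbf u)=\partial P_\Gamma(\mathbf u)$. (d) For each $\mathbf u\in\mathbb R^n$, $h_\Gamma$ is an affine function on $\partial P_\Gamma(\mathbf u)$. (e) $h_\Gamma(\mathbf p)=-P_\Gamma^*(\mathbf p)$ for each $\mathbf p\in\Pi_\Gamma$. -/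

import Mathlib

open Filter Topology

namespace NNSOFT

/-- The box `⟨m⟩ = ⟨m₁⟩ × ⋯ × ⟨m_d⟩ ⊆ ℤ^d`, where `⟨r⟩ = {1, …, r}`. -/
noncomputable def box {d : ℕ} (m : Fin d → ℕ+) : Finset (Fin d → ℤ) :=
  Finset.Icc 1 (fun k => ((m k : ℕ) : ℤ))

/-- The volume `m₁ ⋯ m_d` of the box `⟨m⟩`. -/
def vol {d : ℕ} (m : Fin d → ℕ+) : ℕ := ∏ k, (m k : ℕ)

/-- The set `C_Γ(ℤ^d)` of all `Γ`-colorings of `ℤ^d`: whenever `x` and `x + e_k` are neighbors,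
their colors form a directed edge of `Γ_k`. -/
def latticeColorings {d n : ℕ} (Γ : Fin d → Digraph (Fin n)) : Set ((Fin d → ℤ) → Fin n) :=
  {φ | ∀ (x : Fin d → ℤ) (k : Fin d), (Γ k).Adj (φ x) (φ (x + Pi.single k 1))}

open Classical in
/-- The (finite) set `C_Γ(⟨m⟩)` of all `Γ`-allowed colorings of the box `⟨m⟩`. -/
noncomputable def boxColorings {d n : ℕ} (Γ : Fin d → Digraph (Fin n)) (m : Fin d → ℕ+) :
    Finset (box m → Fin n) :=
  Finset.univ.filter fun φ =>
    ∀ (k : Fin d) (x y : box m), (y : Fin d → ℤ) = (x : Fin d → ℤ) + Pi.single k 1 →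
      (Γ k).Adj (φ x) (φ y)

/-- The color frequency vector `c(φ)`: `c(φ)_i` is the number of sites with color `i`. -/
noncomputable def colorCount {d n : ℕ} {m : Fin d → ℕ+} (φ : box m → Fin n) (i : Fin n) : ℕ :=
  (Finset.univ.filter fun x => φ x = i).card

/-- The grand partition function `Z_Γ(m, u) = ∑_{φ ∈ C_Γ(⟨m⟩)} exp (c(φ)ᵀ u)`. -/
noncomputable def partitionFn {d n : ℕ} (Γ : Fin d → Digraph (Fin n)) (m : Fin d → ℕ+)
    (u : Fin n → ℝ) : ℝ :=
  ∑ φ ∈ boxColorings Γ m, Real.exp (∑ i, (colorCount φ i : ℝ) * u i)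

/-- The pressure `P_Γ(u) = lim_{m → ∞} log Z_Γ(m, u) / vol m`. The filter `atTop` on multi-indices
says that every coordinate of `m` tends to infinity. -/
noncomputable def pressure {d n : ℕ} (Γ : Fin d → Digraph (Fin n)) (u : Fin n → ℝ) : ℝ :=
  limUnder atTop fun m : Fin d → ℕ+ => Real.log (partitionFn Γ m u) / (vol m : ℝ)

open Classical in
/-- The set `C_Γ(⟨m⟩, c)` of `Γ`-allowed colorings of `⟨m⟩` with color frequency vector `c`. -/
noncomputable def boxColoringsWith {d n : ℕ} (Γ : Fin d → Digraph (Fin n)) (m : Fin d → ℕ+)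
    (c : Fin n → ℕ) : Finset (box m → Fin n) :=
  (boxColorings Γ m).filter fun φ => colorCount φ = c

/-- The sequences of boxes `⟨m_q⟩` and of color frequency vectors `c_q ∈ Π_n(vol m_q)` that
realize the color density `p`: `m_q → ∞`, `C_Γ(⟨m_q⟩, c_q) ≠ ∅` for all `q`, and
`c_q / vol m_q → p`. -/
structure Realizes {d n : ℕ} (Γ : Fin d → Digraph (Fin n)) (p : Fin n → ℝ)
    (m : ℕ → Fin d → ℕ+) (c : ℕ → Fin n → ℕ) : Prop where
  sum_eq : ∀ q, ∑ i, c q i = vol (m q)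
  tendsto_box : ∀ k, Tendsto (fun q => (m q k : ℕ)) atTop atTop
  nonempty : ∀ q, (boxColoringsWith Γ (m q) (c q)).Nonempty
  tendsto_density : Tendsto (fun q i => (c q i : ℝ) / (vol (m q) : ℝ)) atTop (𝓝 p)

/-- The set `Π_Γ` of all density points: the probability vectors that are realized by some
sequence. -/
def densityPoints {d n : ℕ} (Γ : Fin d → Digraph (Fin n)) : Set (Fin n → ℝ) :=
  {p | p ∈ stdSimplex ℝ (Fin n) ∧ ∃ m c, Realizes Γ p m c}

/-- The density entropy `h_Γ(p)`: the supremum, over all sequences that realize `p`, of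
`limsup_q log #C_Γ(⟨m_q⟩, c_q) / vol m_q`. All the quotients lie in `[0, log n]`, so that the
limsups and, for `p ∈ Π_Γ`, the supremum are those of nonempty bounded sets of reals. -/
noncomputable def densityEntropy {d n : ℕ} (Γ : Fin d → Digraph (Fin n)) (p : Fin n → ℝ) : ℝ :=
  sSup {s : ℝ | ∃ m c, Realizes Γ p m c ∧
    s = limsup (fun q => Real.log ((boxColoringsWith Γ (m q) (c q)).card : ℝ) /
      (vol (m q) : ℝ)) atTop}

/-- `π_Γ(u)`: the set of all points of `Π_Γ` at which `p ↦ pᵀ u + h_Γ(p)` attains its maximum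
over `Π_Γ`. -/
def equilibriumDensities {d n : ℕ} (Γ : Fin d → Digraph (Fin n)) (u : Fin n → ℝ) :
    Set (Fin n → ℝ) :=
  {p | p ∈ densityPoints Γ ∧
    IsMaxOn (fun p' => p' ⬝ᵥ u + densityEntropy Γ p') (densityPoints Γ) p}

/-- The subdifferential `∂f(x)` of a function `f : ℝ^n → ℝ`. -/
def subdifferential {n : ℕ} (f : (Fin n → ℝ) → ℝ) (x : Fin n → ℝ) : Set (Fin n → ℝ) :=
  {y | ∀ z, f x + y ⬝ᵥ (z - x) ≤ f z}

/-- The conjugate `f^*(y) = sup_x (xᵀ y - f(x))`, with values in the extended reals. -/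
noncomputable def conjugate {n : ℕ} (f : (Fin n → ℝ) → ℝ) (y : Fin n → ℝ) : EReal :=
  ⨆ x : Fin n → ℝ, ((x ⬝ᵥ y - f x : ℝ) : EReal)

/-- The effective domain of an extended-real-valued function. -/
def effectiveDomain {n : ℕ} (g : (Fin n → ℝ) → EReal) : Set (Fin n → ℝ) :=
  {y | g y < ⊤}

/-- A friendly set of colorings, given by its members `F m ⊆ C_Γ(⟨m⟩)` on each box: whenever a
shifted box `⟨k⟩ + i` is the disjoint union of `⟨m⟩` and `⟨l⟩ + j`, and `⟨m⟩` is colored by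
`α ∈ F m` and `⟨l⟩ + j` by `β ∈ F l`, the combined coloring, shifted back to `⟨k⟩`, is in `F k`. -/
structure IsFriendlyFamily {d n : ℕ} (Γ : Fin d → Digraph (Fin n))
    (F : ∀ m : Fin d → ℕ+, Set (box m → Fin n)) : Prop where
  allowed : ∀ m, ∀ α ∈ F m, α ∈ boxColorings Γ m
  glue : ∀ (m l k : Fin d → ℕ+) (i j : Fin d → ℤ),
    Disjoint (box m : Set (Fin d → ℤ)) ((fun x => x + j) '' (box l : Set (Fin d → ℤ))) →
    (box m : Set (Fin d → ℤ)) ∪ (fun x => x + j) '' (box l : Set (Fin d → ℤ)) =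
      (fun x => x + i) '' (box k : Set (Fin d → ℤ)) →
    ∀ α ∈ F m, ∀ β ∈ F l, ∀ δ : box k → Fin n,
      (∀ (x : box k) (y : box m), (x : Fin d → ℤ) + i = y → δ x = α y) →
      (∀ (x : box k) (y : box l), (x : Fin d → ℤ) + i = (y : Fin d → ℤ) + j → δ x = β y) →
      δ ∈ F k

/-- `Γ` is friendly: for some friendly set and some constant vector `b ∈ ℕ^d` (with positive
entries), every `Γ`-allowed coloring `α` of a box `⟨m⟩` extends to the padded box, i.e. some member
of the friendly set on `⟨m + 2b⟩` colors `⟨m⟩ + b` by `α`. -/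
def IsFriendly {d n : ℕ} (Γ : Fin d → Digraph (Fin n)) : Prop :=
  ∃ F : ∀ m : Fin d → ℕ+, Set (box m → Fin n), IsFriendlyFamily Γ F ∧
    ∃ b : Fin d → ℕ+, ∀ (m : Fin d → ℕ+), ∀ α ∈ boxColorings Γ m,
      ∃ δ ∈ F (fun k => m k + 2 * b k),
        ∀ (x : box m) (y : box (fun k => m k + 2 * b k)),
          (y : Fin d → ℤ) = (x : Fin d → ℤ) + (fun k => ((b k : ℕ) : ℤ)) → δ y = α x

end NNSOFT

/-!
# Pressure and density entropy of a friendly shift of finite type are convex conjugates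

Let `F` be the friendly family and `b` the padding vector. The proof is carried by the set
`finiteHypograph F` of pairs `(p, t)` such that, on some box, `F` has members of color density `p`
and entropy per site at least `t`. Gluing makes color counts add and numbers of colorings multiply
(`card_membersWith_mul_le`). Hence a pair that occurs on one box occurs on all its multiples
(`card_membersWith_pow_le`), and `finiteHypograph F` contains the midpoints of its points
(`midpoint_mem_finiteHypograph`). Its closure `K` is therefore convex.

Padding or truncating a box changes a number of colorings by a factor that is exponential only in
the number of sites affected (`exists_fiber`), which is negligible when the box is large. This has
two consequences. First, `K` is the hypograph of the density entropy on the set of density points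
(`mem_closure_iff_le_densityEntropy`): allowed colorings extend to members of `F` on slightly larger
boxes, and members of `F` tile arbitrarily large boxes. Thus the set of density points is convex and
the entropy is concave. Second, the pressure exists and `P(u)` is the supremum of `pᵀ u + t` over
`finiteHypograph F` (`isLUB_pressure`): the upper bound extends colorings and uses that there are only
polynomially many color counts, and the lower bound restricts a tiling of a slightly larger box.

What remains is Fenchel duality for the closed convex set `K`. By Hahn-Banach, a point outside
`K` is separated from it by a non-vertical hyperplane, since entropies are bounded by `log n`
(`exists_pressure_lt`). Hence `-h` is the conjugate of `P` on the density points, and the conjugate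
is infinite elsewhere. The subdifferential at `u` is the set of equality in the Fenchel inequality
(`mem_subdifferential_iff`), and on it `h(p) = P(u) - pᵀ u` is affine.
-/

open Filter Topology

namespace NNSOFT

variable {d n : ℕ}

/-! ### Counting colors -/

/-- The number of points of each color, for a coloring of any finite type. On a box this is
`colorCount`. -/
def countColors {X : Type*} [Fintype X] (φ : X → Fin n) (i : Fin n) : ℕ :=
  ∑ x, if φ x = i then 1 else 0

lemma colorCount_eq {m : Fin d → ℕ+} (φ : box m → Fin n) : colorCount φ = countColors φ := by
  funext i
  exact Finset.card_filter _ _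

lemma sum_countColors {X : Type*} [Fintype X] (φ : X → Fin n) :
    ∑ i, countColors φ i = Fintype.card X := by
  simp only [countColors]
  rw [Finset.sum_comm]
  simp

lemma countColors_sumElim {X Y : Type*} [Fintype X] [Fintype Y] (φ : X → Fin n)
    (ψ : Y → Fin n) : countColors (Sum.elim φ ψ) = countColors φ + countColors ψ := by
  funext i
  exact Fintype.sum_sum_type _

lemma countColors_comp_equiv {X Y : Type*} [Fintype X] [Fintype Y] (e : X ≃ Y) (φ : Y → Fin n) :
    countColors (φ ∘ e) = countColors φ := by
  funext i
  exact e.sum_comp fun y => if φ y = i then 1 else 0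

lemma card_box (m : Fin d → ℕ+) : Fintype.card (box m) = vol m := by
  rw [Fintype.card_coe, box, Pi.card_Icc, vol]
  simp

lemma vol_pos (m : Fin d → ℕ+) : 0 < vol m := Finset.prod_pos fun k _ => (m k).pos

lemma vol_mul (q m : Fin d → ℕ+) : vol (q * m) = vol q * vol m := by
  simp [vol, Finset.prod_mul_distrib]

lemma vol_mono {m m' : Fin d → ℕ+} (h : m ≤ m') : vol m ≤ vol m' :=
  Finset.prod_le_prod' fun k _ => h k

lemma mem_box {m : Fin d → ℕ+} {x : Fin d → ℤ} :
    x ∈ box m ↔ ∀ k, 1 ≤ x k ∧ x k ≤ (m k : ℕ) := by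
  simp only [box, Finset.mem_Icc, Pi.le_def, Pi.one_apply]
  exact forall_and.symm

lemma sum_colorCount {m : Fin d → ℕ+} (φ : box m → Fin n) : ∑ i, colorCount φ i = vol m := by
  rw [colorCount_eq, sum_countColors, card_box]

/-! ### Gluing and tiling -/

open Classical in
/-- The members of a family of sets of colorings on the box `⟨m⟩` with color count `c`. -/
noncomputable def membersWith (F : ∀ m : Fin d → ℕ+, Set (box m → Fin n)) (m : Fin d → ℕ+)
    (c : Fin n → ℕ) : Finset (box m → Fin n) :=
  Finset.univ.filter fun φ => φ ∈ F m ∧ colorCount φ = c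

lemma mem_membersWith {F : ∀ m : Fin d → ℕ+, Set (box m → Fin n)} {m : Fin d → ℕ+}
    {c : Fin n → ℕ} {φ : box m → Fin n} :
    φ ∈ membersWith F m c ↔ φ ∈ F m ∧ colorCount φ = c := by
  simp [membersWith]

lemma mem_boxColoringsWith {Γ : Fin d → Digraph (Fin n)} {m : Fin d → ℕ+}
    {c : Fin n → ℕ} {φ : box m → Fin n} :
    φ ∈ boxColoringsWith Γ m c ↔ φ ∈ boxColorings Γ m ∧ colorCount φ = c := by
  simp [boxColoringsWith]

lemma mem_boxColorings {Γ : Fin d → Digraph (Fin n)} {m : Fin d → ℕ+} {φ : box m → Fin n} :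
    φ ∈ boxColorings Γ m ↔ ∀ (k : Fin d) (x y : box m),
      (y : Fin d → ℤ) = (x : Fin d → ℤ) + Pi.single k 1 → (Γ k).Adj (φ x) (φ y) := by
  simp [boxColorings]

/-- A box of side `m k + a` in direction `k` is the disjoint union of two boxes, of sides `m k`
and `a` in that direction. -/
lemma exists_equiv_glue (m : Fin d → ℕ+) (k : Fin d) (a : ℕ+) :
    ∃ e : box m ⊕ box (Function.update m k a) ≃ box (Function.update m k (m k + a)),
      (∀ x, ((e (Sum.inl x) : box _) : Fin d → ℤ) = x) ∧
      ∀ x, ((e (Sum.inr x) : box _) : Fin d → ℤ) = (x : Fin d → ℤ) + Pi.single k ((m k : ℕ) : ℤ) := by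
  have hf : ∀ x : box m, (x : Fin d → ℤ) ∈ box (Function.update m k (m k + a)) := by
    rintro ⟨x, hx⟩
    rw [mem_box] at hx ⊢
    intro j
    rcases eq_or_ne j k with rfl | hj
    · have := hx j
      simp only [Function.update_self, PNat.add_coe]
      push_cast
      omega
    · simpa [hj] using hx j
  have hg : ∀ x : box (Function.update m k a), (x : Fin d → ℤ) + Pi.single k ((m k : ℕ) : ℤ) ∈
      box (Function.update m k (m k + a)) := by
    rintro ⟨x, hx⟩
    rw [mem_box] at hx ⊢
    intro j
    rcases eq_or_ne j k with rfl | hj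
    · have := hx j
      simp only [Function.update_self, PNat.add_coe, Pi.add_apply, Pi.single_eq_same] at this ⊢
      push_cast
      omega
    · simpa [hj] using hx j
  let f : box m ⊕ box (Function.update m k a) → box (Function.update m k (m k + a)) :=
    Sum.elim (fun x => ⟨x, hf x⟩) fun x => ⟨(x : Fin d → ℤ) + Pi.single k ((m k : ℕ) : ℤ), hg x⟩
  have hdis : ∀ (x : box m) (y : box (Function.update m k a)),
      (x : Fin d → ℤ) ≠ (y : Fin d → ℤ) + Pi.single k ((m k : ℕ) : ℤ) := by
    intro x y h
    have h1 := (mem_box.1 x.2 k).2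
    have h2 := (mem_box.1 y.2 k).1
    have h3 := congrFun h k
    simp only [Pi.add_apply, Pi.single_eq_same] at h3
    omega
  refine ⟨Equiv.ofBijective f ⟨?_, ?_⟩, fun _ => rfl, fun _ => rfl⟩
  · rintro (x | x) (y | y) h <;> simp only [f, Sum.elim_inl, Sum.elim_inr, Subtype.mk.injEq] at h
    · exact congrArg _ (Subtype.ext h)
    · exact (hdis _ _ h).elim
    · exact (hdis _ _ h.symm).elim
    · exact congrArg _ (Subtype.ext (add_right_cancel h))
  · rintro ⟨z, hz⟩
    rw [mem_box] at hz
    by_cases hzk : z k ≤ (m k : ℕ)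
    · refine ⟨Sum.inl ⟨z, mem_box.2 fun j => ?_⟩, rfl⟩
      rcases eq_or_ne j k with rfl | hj
      · exact ⟨(hz j).1, hzk⟩
      · simpa [hj] using hz j
    · refine ⟨Sum.inr ⟨z - Pi.single k ((m k : ℕ) : ℤ), mem_box.2 fun j => ?_⟩,
        Subtype.ext (sub_add_cancel _ _)⟩
      rcases eq_or_ne j k with rfl | hj
      · have := hz j
        simp only [Function.update_self, PNat.add_coe, Pi.sub_apply, Pi.single_eq_same] at this ⊢
        push_cast at this
        omega
      · simpa [hj] using hz j

/-- Gluing members of a friendly family along direction `k` is injective and adds the color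
counts. -/
lemma card_membersWith_mul_le {Γ : Fin d → Digraph (Fin n)}
    {F : ∀ m : Fin d → ℕ+, Set (box m → Fin n)} (hF : IsFriendlyFamily Γ F)
    (m : Fin d → ℕ+) (k : Fin d) (a : ℕ+) (c c' : Fin n → ℕ) :
    (membersWith F m c).card * (membersWith F (Function.update m k a) c').card ≤
      (membersWith F (Function.update m k (m k + a)) (c + c')).card := by
  obtain ⟨e, he1, he2⟩ := exists_equiv_glue m k a
  rw [← Finset.card_product]
  refine Finset.card_le_card_of_injOn (fun p => Sum.elim p.1 p.2 ∘ e.symm) ?_ ?_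
  · rintro ⟨α, β⟩ h
    simp only [Finset.coe_product, Set.mem_prod, Finset.mem_coe, mem_membersWith] at h ⊢
    obtain ⟨⟨hα, rfl⟩, hβ, rfl⟩ := h
    refine ⟨hF.glue m (Function.update m k a) _ 0 (Pi.single k ((m k : ℕ) : ℤ)) ?_ ?_
      α hα β hβ _ ?_ ?_, ?_⟩
    · rw [Set.disjoint_left]
      rintro _ hx ⟨y, hy, rfl⟩
      have : e (Sum.inl ⟨_, hx⟩) = e (Sum.inr ⟨y, hy⟩) :=
        Subtype.ext ((he1 ⟨_, hx⟩).trans (he2 ⟨y, hy⟩).symm)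
      simpa using e.injective this
    · ext z
      simp only [Set.mem_union, Set.mem_image, Finset.mem_coe, add_zero, exists_eq_right]
      constructor
      · rintro (hz | ⟨y, hy, rfl⟩)
        · have := (e (Sum.inl ⟨z, hz⟩)).2
          rwa [he1] at this
        · have := (e (Sum.inr ⟨y, hy⟩)).2
          rwa [he2] at this
      · intro hz
        obtain ⟨x | x, hx⟩ := e.surjective ⟨z, hz⟩
        · have := he1 x
          rw [hx] at this
          exact Or.inl ((show z = x from this) ▸ x.2)
        · have := he2 x
          rw [hx] at this
          exact Or.inr ⟨x, x.2, this.symm⟩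
    · intro x y hxy
      have : x = e (Sum.inl y) := Subtype.ext (by rw [he1, ← hxy, add_zero])
      simp [this]
    · intro x y hxy
      have : x = e (Sum.inr y) := Subtype.ext (by rw [he2, ← hxy, add_zero])
      simp [this]
    · rw [colorCount_eq, colorCount_eq, colorCount_eq, countColors_comp_equiv,
        countColors_sumElim]
  · rintro ⟨α, β⟩ - ⟨α', β'⟩ - h
    have h' : Sum.elim α β = Sum.elim α' β' := e.symm.surjective.injective_comp_right h
    exact Prod.ext (funext fun x => congrFun h' (Sum.inl x))
      (funext fun x => congrFun h' (Sum.inr x))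

/-- Gluing `a` translates of a box along direction `k`. -/
lemma card_membersWith_pow_le_update {Γ : Fin d → Digraph (Fin n)}
    {F : ∀ m : Fin d → ℕ+, Set (box m → Fin n)} (hF : IsFriendlyFamily Γ F)
    (m : Fin d → ℕ+) (k : Fin d) (c : Fin n → ℕ) (a : ℕ+) :
    (membersWith F m c).card ^ (a : ℕ) ≤
      (membersWith F (Function.update m k (a * m k)) ((a : ℕ) • c)).card := by
  induction a using PNat.recOn with
  | one => rw [one_mul, Function.update_eq_self, PNat.one_coe, pow_one, one_smul]
  | succ a ih =>
    have h := card_membersWith_mul_le hF m k (a * m k) c ((a : ℕ) • c)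
    rw [show m k + a * m k = (a + 1) * m k by ring,
      show c + (a : ℕ) • c = ((a + 1 : ℕ+) : ℕ) • c by push_cast; rw [add_smul, one_smul, add_comm]]
      at h
    calc _ = (membersWith F m c).card * (membersWith F m c).card ^ (a : ℕ) := by
          rw [PNat.add_coe, PNat.one_coe, pow_succ']
      _ ≤ _ := (Nat.mul_le_mul_left _ ih).trans h

/-- Tiling `⟨q m⟩` by `vol q` translates of `⟨m⟩`. -/
lemma card_membersWith_pow_le {Γ : Fin d → Digraph (Fin n)}
    {F : ∀ m : Fin d → ℕ+, Set (box m → Fin n)} (hF : IsFriendlyFamily Γ F)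
    (m q : Fin d → ℕ+) (c : Fin n → ℕ) :
    (membersWith F m c).card ^ vol q ≤ (membersWith F (q * m) (vol q • c)).card := by
  have key : ∀ s : Finset (Fin d), (membersWith F m c).card ^ (∏ k ∈ s, (q k : ℕ)) ≤
      (membersWith F (s.piecewise (q * m) m) ((∏ k ∈ s, (q k : ℕ)) • c)).card := by
    intro s
    induction s using Finset.induction_on with
    | empty => rw [Finset.piecewise_empty, Finset.prod_empty, pow_one, one_smul]
    | insert k s hk ih =>
      rw [Finset.prod_insert hk, mul_comm (q k : ℕ), pow_mul,
        mul_comm _ (q k : ℕ), mul_smul, Finset.piecewise_insert]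
      have h := card_membersWith_pow_le_update hF (s.piecewise (q * m) m) k
        ((∏ k ∈ s, (q k : ℕ)) • c) (q k)
      rw [Finset.piecewise_eq_of_notMem _ _ _ hk] at h
      refine le_trans (Nat.pow_le_pow_left ih _) ?_
      rw [Pi.mul_apply]
      exact h
  have h := key Finset.univ
  rwa [Finset.piecewise_univ] at h

/-! ### Restricting and extending colorings -/

/-- Fixing the most popular values off the range of an embedding `X ↪ Y` keeps at least the
proportion `n ^ (|X| - |Y|)` of a finite set `A` of colorings of `Y`. On the part that is kept,
restriction to `X` is injective and subtracts a constant from the color count. -/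
lemma exists_fiber {X Y : Type*} [Fintype X] [Fintype Y] (e : X ↪ Y)
    (A : Finset (Y → Fin n)) (hA : A.Nonempty) :
    ∃ B ⊆ A, B.Nonempty ∧ ∃ g : Fin n → ℕ,
      A.card ≤ n ^ (Fintype.card Y - Fintype.card X) * B.card ∧
      Set.InjOn (fun δ : Y → Fin n => δ ∘ e) B ∧
      (∀ δ ∈ B, countColors δ = countColors (δ ∘ e) + g) ∧
      ∑ i, g i = Fintype.card Y - Fintype.card X := by
  classical
  let Z := {y : Y // y ∉ Set.range e}
  have hZ : Fintype.card Z = Fintype.card Y - Fintype.card X := by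
    rw [← Fintype.card_range e]
    exact Fintype.card_subtype_compl _
  let E : X ⊕ Z ≃ Y := ((Equiv.ofInjective e e.injective).sumCongr (Equiv.refl _)).trans
    (Equiv.Set.sumCompl (Set.range e))
  have hE1 : ∀ x, E (Sum.inl x) = e x := fun x => rfl
  have hE2 : ∀ z : Z, E (Sum.inr z) = z := fun z => rfl
  let r : (Y → Fin n) → (Z → Fin n) := fun δ z => δ z
  have hsplit : ∀ δ : Y → Fin n, δ ∘ E = Sum.elim (δ ∘ e) (r δ) := by
    intro δ
    funext x
    rcases x with x | z
    · simp [hE1]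
    · simp [hE2, r]
  -- The pigeonhole principle for the colorings off the range of `e`.
  obtain ⟨γ, hγ, hcard⟩ : ∃ γ ∈ A.image r, A.card ≤
      n ^ (Fintype.card Y - Fintype.card X) * (A.filter fun δ => r δ = γ).card := by
    by_contra! hcon
    have h1 : A.card = ∑ γ ∈ A.image r, (A.filter fun δ => r δ = γ).card :=
      Finset.card_eq_sum_card_image r A
    have h2 : (A.image r).card ≤ n ^ (Fintype.card Y - Fintype.card X) := by
      calc (A.image r).card ≤ Fintype.card (Z → Fin n) := Finset.card_le_univ _
        _ = _ := by rw [Fintype.card_fun, Fintype.card_fin, hZ]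
    have h3 : n ^ (Fintype.card Y - Fintype.card X) * A.card <
        (A.image r).card * A.card := by
      calc _ = ∑ γ ∈ A.image r, n ^ (Fintype.card Y - Fintype.card X) *
            (A.filter fun δ => r δ = γ).card := by rw [← Finset.mul_sum, ← h1]
        _ < ∑ γ ∈ A.image r, A.card := Finset.sum_lt_sum_of_nonempty (hA.image r) hcon
        _ = _ := by rw [Finset.sum_const, smul_eq_mul]
    exact absurd (Nat.mul_le_mul_right A.card h2) (not_le.2 h3)
  obtain ⟨δ₀, hδ₀, rfl⟩ := Finset.mem_image.1 hγ
  refine ⟨A.filter fun δ => r δ = r δ₀, Finset.filter_subset _ _,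
    ⟨δ₀, Finset.mem_filter.2 ⟨hδ₀, rfl⟩⟩, countColors (r δ₀), hcard, ?_, ?_, ?_⟩
  · intro δ hδ δ' hδ' h
    simp only [Finset.coe_filter, Set.mem_ofPred_eq] at hδ hδ' h
    refine E.surjective.injective_comp_right ?_
    change δ ∘ E = δ' ∘ E
    rw [hsplit, hsplit, h, hδ.2, hδ'.2]
  · intro δ hδ
    rw [← countColors_comp_equiv E, hsplit, countColors_sumElim, (Finset.mem_filter.1 hδ).2]
  · rw [sum_countColors, hZ]

/-- The inclusion of boxes. -/
def boxInclusion {m M : Fin d → ℕ+} (h : m ≤ M) : box m ↪ box M where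
  toFun x := ⟨x, mem_box.2 fun k => ⟨(mem_box.1 x.2 k).1,
    (mem_box.1 x.2 k).2.trans (by exact_mod_cast h k)⟩⟩
  inj' x y hxy := Subtype.ext (congrArg (fun z : box M => (z : Fin d → ℤ)) hxy)

lemma comp_boxInclusion_mem {Γ : Fin d → Digraph (Fin n)} {m M : Fin d → ℕ+} (h : m ≤ M)
    {δ : box M → Fin n} (hδ : δ ∈ boxColorings Γ M) : δ ∘ boxInclusion h ∈ boxColorings Γ m :=
  mem_boxColorings.2 fun k x y hxy =>
    mem_boxColorings.1 hδ k (boxInclusion h x) (boxInclusion h y) hxy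

/-- Restriction from a box to a smaller one loses at most the colors of the sites left out. -/
lemma exists_card_le_of_restrict {Γ : Fin d → Digraph (Fin n)} {m M : Fin d → ℕ+} (h : m ≤ M)
    {C : Fin n → ℕ} (hC : (boxColoringsWith Γ M C).Nonempty) :
    ∃ c g : Fin n → ℕ, C = c + g ∧ ∑ i, g i = vol M - vol m ∧
      (boxColoringsWith Γ m c).Nonempty ∧
      (boxColoringsWith Γ M C).card ≤
        n ^ (vol M - vol m) * (boxColoringsWith Γ m c).card := by
  classical
  obtain ⟨B, hBA, ⟨δ₀, hδ₀⟩, g, hcard, hinj, hcount, hg⟩ := exists_fiber (boxInclusion h) _ hC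
  simp only [card_box, ← colorCount_eq] at hcard hg hcount
  have hB : ∀ δ ∈ B, C = colorCount (δ ∘ boxInclusion h) + g := fun δ hδ => by
    rw [← (mem_boxColoringsWith.1 (hBA hδ)).2]
    exact hcount δ hδ
  have hmap : ∀ δ ∈ B, δ ∘ boxInclusion h ∈
      boxColoringsWith Γ m (colorCount (δ₀ ∘ boxInclusion h)) := fun δ hδ =>
    mem_boxColoringsWith.2 ⟨comp_boxInclusion_mem h (mem_boxColoringsWith.1 (hBA hδ)).1,
      add_right_cancel ((hB δ hδ).symm.trans (hB δ₀ hδ₀))⟩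
  exact ⟨_, g, hB δ₀ hδ₀, hg, ⟨_, hmap _ hδ₀⟩, hcard.trans
    (Nat.mul_le_mul_left _ (Finset.card_le_card_of_injOn _ hmap hinj))⟩

/-- Every set of allowed colorings with a given color count extends, up to a factor that is
exponential only in the number of sites added, to members of the friendly family with a given
color count on the padded box. -/
lemma exists_card_le_of_extend {Γ : Fin d → Digraph (Fin n)}
    {F : ∀ m : Fin d → ℕ+, Set (box m → Fin n)} {b : Fin d → ℕ+}
    (hb : ∀ (m : Fin d → ℕ+), ∀ α ∈ boxColorings Γ m,
      ∃ δ ∈ F (fun k => m k + 2 * b k),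
        ∀ (x : box m) (y : box (fun k => m k + 2 * b k)),
          (y : Fin d → ℤ) = (x : Fin d → ℤ) + (fun k => ((b k : ℕ) : ℤ)) → δ y = α x)
    {m : Fin d → ℕ+} {c : Fin n → ℕ} (hc : (boxColoringsWith Γ m c).Nonempty) :
    ∃ g : Fin n → ℕ, ∑ i, g i = vol (m + 2 * b) - vol m ∧
      (membersWith F (m + 2 * b) (c + g)).Nonempty ∧
      (boxColoringsWith Γ m c).card ≤
        n ^ (vol (m + 2 * b) - vol m) * (membersWith F (m + 2 * b) (c + g)).card := by
  classical
  have : Nonempty (box (fun k => m k + 2 * b k) → Fin n) :=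
    let ⟨α, hα⟩ := hc
    let ⟨δ, _⟩ := hb m α (mem_boxColoringsWith.1 hα).1
    ⟨δ⟩
  choose! f hf hfe using hb m
  let e : box m ↪ box (m + 2 * b) :=
    { toFun := fun x => ⟨(x : Fin d → ℤ) + fun k => ((b k : ℕ) : ℤ), mem_box.2 fun k => by
        have h1 := mem_box.1 x.2 k
        have h2 := (b k).pos
        have h3 : (((m + 2 * b) k : ℕ+) : ℕ) = m k + 2 * b k := rfl
        rw [h3]
        simp only [Pi.add_apply]
        push_cast
        omega⟩
      inj' := fun x y hxy => Subtype.ext (add_right_cancel (Subtype.ext_iff.1 hxy)) }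
  have hfe' : ∀ α ∈ boxColorings Γ m, f α ∘ e = α := fun α hα => funext fun x =>
    hfe α hα x (e x) rfl
  have hmem : ∀ α ∈ boxColoringsWith Γ m c, α ∈ boxColorings Γ m := fun α hα =>
    (mem_boxColoringsWith.1 hα).1
  have hfinj : Set.InjOn f (boxColoringsWith Γ m c) := fun α hα β hβ h => by
    rw [← hfe' α (hmem α hα), h, hfe' β (hmem β hβ)]
  obtain ⟨B, hBA, hne, g, hcard, -, hcount, hg⟩ := exists_fiber e _ (hc.image f)
  rw [Finset.card_image_of_injOn hfinj] at hcard
  simp only [card_box] at hcard hg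
  have hsub : B ⊆ membersWith F (m + 2 * b) (c + g) := by
    intro δ hδ
    obtain ⟨α, hα, rfl⟩ := Finset.mem_image.1 (hBA hδ)
    refine mem_membersWith.2 ⟨hf α (hmem α hα), ?_⟩
    rw [colorCount_eq, hcount _ hδ, hfe' α (hmem α hα), ← colorCount_eq,
      (mem_boxColoringsWith.1 hα).2]
  exact ⟨g, hg, hne.mono hsub, hcard.trans (Nat.mul_le_mul_left _ (Finset.card_le_card hsub))⟩

/-! ### Entropies and densities of finite boxes -/

/-- The color density `c / vol m` of a color count on the box `⟨m⟩`. -/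
noncomputable def density (m : Fin d → ℕ+) (c : Fin n → ℕ) : Fin n → ℝ :=
  fun i => (c i : ℝ) / (vol m : ℝ)

lemma vol_pos_real (m : Fin d → ℕ+) : (0 : ℝ) < vol m := by exact_mod_cast vol_pos m

lemma membersWith_subset {Γ : Fin d → Digraph (Fin n)}
    {F : ∀ m : Fin d → ℕ+, Set (box m → Fin n)} (hF : IsFriendlyFamily Γ F)
    (m : Fin d → ℕ+) (c : Fin n → ℕ) : membersWith F m c ⊆ boxColoringsWith Γ m c := fun φ hφ =>
  have h := mem_membersWith.1 hφ
  mem_boxColoringsWith.2 ⟨hF.allowed m φ h.1, h.2⟩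

lemma sum_eq_vol_of_mem {Γ : Fin d → Digraph (Fin n)} {m : Fin d → ℕ+} {c : Fin n → ℕ}
    (h : (boxColoringsWith Γ m c).Nonempty) : ∑ i, c i = vol m := by
  obtain ⟨φ, hφ⟩ := h
  rw [← (mem_boxColoringsWith.1 hφ).2, sum_colorCount]

lemma density_mem_stdSimplex {m : Fin d → ℕ+} {c : Fin n → ℕ} (h : ∑ i, c i = vol m) :
    density m c ∈ stdSimplex ℝ (Fin n) := by
  refine ⟨fun i => by unfold density; positivity, ?_⟩
  have := vol_pos_real m
  simp only [density]
  rw [← Finset.sum_div, ← Nat.cast_sum, h, div_self this.ne']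

lemma vol_mul_density_dotProduct (m : Fin d → ℕ+) (c : Fin n → ℕ) (u : Fin n → ℝ) :
    (vol m : ℝ) * (density m c ⬝ᵥ u) = ∑ i, (c i : ℝ) * u i := by
  have := (vol_pos_real m).ne'
  simp only [density, dotProduct, Finset.mul_sum]
  exact Finset.sum_congr rfl fun i _ => by field_simp

lemma density_smul (m q : Fin d → ℕ+) (c : Fin n → ℕ) :
    density (q * m) (vol q • c) = density m c := by
  have h1 := (vol_pos_real q).ne'
  have h2 := (vol_pos_real m).ne'
  funext i
  simp only [density, vol_mul, Pi.smul_apply, smul_eq_mul, Nat.cast_mul]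
  field_simp

lemma log_card_div_vol_le {m : Fin d → ℕ+} (A : Finset (box m → Fin n)) :
    Real.log (A.card : ℝ) / (vol m : ℝ) ≤ Real.log n := by
  rw [div_le_iff₀ (vol_pos_real m)]
  rcases A.eq_empty_or_nonempty with rfl | hA
  · simpa using mul_nonneg (Real.log_natCast_nonneg n) (vol_pos_real m).le
  · rw [mul_comm, ← Real.log_pow]
    refine Real.log_le_log (by exact_mod_cast hA.card_pos) ?_
    have : A.card ≤ n ^ vol m := by
      calc A.card ≤ Fintype.card (box m → Fin n) := Finset.card_le_univ _
        _ = _ := by rw [Fintype.card_fun, Fintype.card_fin, card_box]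
    exact_mod_cast this

lemma log_card_div_vol_nonneg {m : Fin d → ℕ+} (A : Finset (box m → Fin n)) :
    0 ≤ Real.log (A.card : ℝ) / (vol m : ℝ) :=
  div_nonneg (Real.log_natCast_nonneg _) (Nat.cast_nonneg _)

lemma log_card_le_of_card_le {a b k : ℕ} (ha : 0 < a) (h : a ≤ n ^ k * b) :
    Real.log a ≤ k * Real.log n + Real.log b := by
  have hpos : 0 < n ^ k * b := ha.trans_le h
  have h1 : ((n : ℝ) ^ k) ≠ 0 := by exact_mod_cast (Nat.pos_of_mul_pos_right hpos).ne'
  have h2 : (b : ℝ) ≠ 0 := by exact_mod_cast (Nat.pos_of_mul_pos_left hpos).ne'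
  rw [← Real.log_pow, ← Real.log_mul h1 h2]
  exact Real.log_le_log (by exact_mod_cast ha) (by exact_mod_cast h)

lemma abs_sum_mul_le (g : Fin n → ℕ) (u : Fin n → ℝ) :
    |∑ i, (g i : ℝ) * u i| ≤ (∑ i, (g i : ℝ)) * ∑ i, |u i| := by
  rw [Finset.sum_mul]
  refine (Finset.abs_sum_le_sum_abs _ _).trans (Finset.sum_le_sum fun i _ => ?_)
  rw [abs_mul, Nat.abs_cast]
  exact mul_le_mul_of_nonneg_left
    (Finset.single_le_sum (f := fun i => |u i|) (fun j _ => abs_nonneg _) (Finset.mem_univ i))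
    (Nat.cast_nonneg _)

/-- The points `(p, t)` such that some box has members of the family `F` with color density `p`
and with entropy per site at least `t`. -/
def finiteHypograph (F : ∀ m : Fin d → ℕ+, Set (box m → Fin n)) : Set ((Fin n → ℝ) × ℝ) :=
  {x | ∃ m c, (membersWith F m c).Nonempty ∧ x.1 = density m c ∧
    x.2 ≤ Real.log ((membersWith F m c).card : ℝ) / (vol m : ℝ)}

lemma finiteHypograph_snd_le {F : ∀ m : Fin d → ℕ+, Set (box m → Fin n)}
    {x : (Fin n → ℝ) × ℝ} (hx : x ∈ finiteHypograph F) : x.2 ≤ Real.log n := by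
  obtain ⟨m, c, -, -, h⟩ := hx
  exact h.trans (log_card_div_vol_le _)

lemma finiteHypograph_fst_mem {Γ : Fin d → Digraph (Fin n)}
    {F : ∀ m : Fin d → ℕ+, Set (box m → Fin n)} (hF : IsFriendlyFamily Γ F)
    {x : (Fin n → ℝ) × ℝ} (hx : x ∈ finiteHypograph F) : x.1 ∈ stdSimplex ℝ (Fin n) := by
  obtain ⟨m, c, hne, h, -⟩ := hx
  rw [h]
  exact density_mem_stdSimplex (sum_eq_vol_of_mem (hne.mono (membersWith_subset hF m c)))

lemma log_card_tile {Γ : Fin d → Digraph (Fin n)}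
    {F : ∀ m : Fin d → ℕ+, Set (box m → Fin n)} (hF : IsFriendlyFamily Γ F)
    {m : Fin d → ℕ+} {c : Fin n → ℕ} (h : (membersWith F m c).Nonempty) (q : Fin d → ℕ+) :
    (membersWith F (q * m) (vol q • c)).Nonempty ∧
      vol q * Real.log ((membersWith F m c).card : ℝ) ≤
        Real.log ((membersWith F (q * m) (vol q • c)).card : ℝ) := by
  have h1 := card_membersWith_pow_le hF m q c
  have h2 : 0 < (membersWith F m c).card ^ vol q := pow_pos h.card_pos _
  refine ⟨Finset.card_pos.1 (h2.trans_le h1), ?_⟩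
  rw [← Real.log_pow]
  exact Real.log_le_log (by exact_mod_cast h2) (by exact_mod_cast h1)

lemma log_card_tile_div {Γ : Fin d → Digraph (Fin n)}
    {F : ∀ m : Fin d → ℕ+, Set (box m → Fin n)} (hF : IsFriendlyFamily Γ F)
    {m : Fin d → ℕ+} {c : Fin n → ℕ} (h : (membersWith F m c).Nonempty) (q : Fin d → ℕ+) :
    Real.log ((membersWith F m c).card : ℝ) / vol m ≤
      Real.log ((membersWith F (q * m) (vol q • c)).card : ℝ) / vol (q * m) := by
  have h1 := vol_pos_real q
  have h2 := vol_pos_real m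
  rw [div_le_div_iff₀ h2 (vol_pos_real _), vol_mul]
  push_cast
  calc _ = vol q * Real.log ((membersWith F m c).card : ℝ) * vol m := by ring
    _ ≤ _ := mul_le_mul_of_nonneg_right (log_card_tile hF h q).2 h2.le

/-- Midpoints stay in the hypograph: tile a common box by both colorings, and glue the two
resulting boxes. -/
lemma midpoint_mem_finiteHypograph (hd : 0 < d) {Γ : Fin d → Digraph (Fin n)}
    {F : ∀ m : Fin d → ℕ+, Set (box m → Fin n)} (hF : IsFriendlyFamily Γ F)
    {x y : (Fin n → ℝ) × ℝ} (hx : x ∈ finiteHypograph F) (hy : y ∈ finiteHypograph F) :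
    (1 / 2 : ℝ) • (x + y) ∈ finiteHypograph F := by
  obtain ⟨m, c, hc, hxc, hxt⟩ := hx
  obtain ⟨l, c', hc', hyc, hyt⟩ := hy
  obtain ⟨h1, -⟩ := log_card_tile hF hc l
  obtain ⟨h2, -⟩ := log_card_tile hF hc' m
  have e1 := hxt.trans (log_card_tile_div hF hc l)
  have e2 := hyt.trans (log_card_tile_div hF hc' m)
  rw [← density_smul m l c] at hxc
  rw [← density_smul l m c'] at hyc
  rw [mul_comm m l] at h2 e2 hyc
  generalize l * m = M at *
  generalize vol l • c = C at *
  generalize vol m • c' = C' at *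
  have h3 := card_membersWith_mul_le hF M ⟨0, hd⟩ (M ⟨0, hd⟩) C C'
  rw [Function.update_eq_self] at h3
  generalize Function.update M ⟨0, hd⟩ (M ⟨0, hd⟩ + M ⟨0, hd⟩) = K at h3
  have hK0 : 0 < (membersWith F K (C + C')).card := (Nat.mul_pos h1.card_pos h2.card_pos).trans_le h3
  have hK := Finset.card_pos.1 hK0
  -- Both volumes are read off from the color counts.
  have hvol : (vol K : ℝ) = 2 * vol M := by
    have a1 := sum_eq_vol_of_mem (h1.mono (membersWith_subset hF _ _))
    have a2 := sum_eq_vol_of_mem (h2.mono (membersWith_subset hF _ _))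
    have a3 := sum_eq_vol_of_mem (hK.mono (membersWith_subset hF _ _))
    simp only [Pi.add_apply, Finset.sum_add_distrib] at a3
    have : vol K = 2 * vol M := by omega
    exact_mod_cast this
  have hM := vol_pos_real M
  refine ⟨K, C + C', hK, ?_, ?_⟩
  · funext i
    simp only [hxc, hyc, Prod.smul_fst, Prod.fst_add, Pi.smul_apply, Pi.add_apply, density,
      smul_eq_mul, hvol, Nat.cast_add]
    field_simp
  · have hlog : Real.log ((membersWith F M C).card : ℝ) + Real.log ((membersWith F M C').card : ℝ)
        ≤ Real.log ((membersWith F K (C + C')).card : ℝ) := by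
      have b1 : ((membersWith F M C).card : ℝ) ≠ 0 := by exact_mod_cast h1.card_pos.ne'
      have b2 : ((membersWith F M C').card : ℝ) ≠ 0 := by exact_mod_cast h2.card_pos.ne'
      rw [← Real.log_mul b1 b2]
      refine Real.log_le_log (by positivity) (by exact_mod_cast h3)
    rw [le_div_iff₀ hM] at e1 e2
    rw [hvol, le_div_iff₀ (by positivity)]
    simp only [Prod.smul_snd, Prod.snd_add, smul_eq_mul]
    linarith

/-! ### Bounds for the partition function -/

lemma log_card_add_le_log_partitionFn {Γ : Fin d → Digraph (Fin n)} {m : Fin d → ℕ+}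
    {c : Fin n → ℕ} (h : (boxColoringsWith Γ m c).Nonempty) (u : Fin n → ℝ) :
    Real.log ((boxColoringsWith Γ m c).card : ℝ) + ∑ i, (c i : ℝ) * u i ≤
      Real.log (partitionFn Γ m u) := by
  have h0 : (0 : ℝ) < (boxColoringsWith Γ m c).card := by exact_mod_cast h.card_pos
  rw [← Real.log_exp (∑ i, (c i : ℝ) * u i), ← Real.log_mul h0.ne' (Real.exp_ne_zero _)]
  refine Real.log_le_log (by positivity) ?_
  calc ((boxColoringsWith Γ m c).card : ℝ) * Real.exp (∑ i, (c i : ℝ) * u i)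
      = ∑ φ ∈ boxColoringsWith Γ m c, Real.exp (∑ i, (colorCount φ i : ℝ) * u i) := by
        rw [← nsmul_eq_mul, ← Finset.sum_const]
        exact Finset.sum_congr rfl fun φ hφ => by rw [(mem_boxColoringsWith.1 hφ).2]
    _ ≤ _ := Finset.sum_le_sum_of_subset_of_nonneg (Finset.filter_subset _ _)
        fun _ _ _ => (Real.exp_pos _).le

lemma partitionFn_pos {Γ : Fin d → Digraph (Fin n)} {m : Fin d → ℕ+}
    (h : (boxColorings Γ m).Nonempty) (u : Fin n → ℝ) : 0 < partitionFn Γ m u :=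
  Finset.sum_pos (fun _ _ => Real.exp_pos _) h

/-- There are at most `(vol m + 1) ^ n` color counts on `⟨m⟩`. -/
lemma log_partitionFn_le {Γ : Fin d → Digraph (Fin n)} {m : Fin d → ℕ+}
    (hne : (boxColorings Γ m).Nonempty) {u : Fin n → ℝ} {B : ℝ}
    (hB : ∀ c, (boxColoringsWith Γ m c).Nonempty →
      Real.log ((boxColoringsWith Γ m c).card : ℝ) + ∑ i, (c i : ℝ) * u i ≤ B) :
    Real.log (partitionFn Γ m u) ≤ n * Real.log (vol m + 1) + B := by
  classical
  have hmaps : ∀ φ ∈ boxColorings Γ m,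
      colorCount φ ∈ Fintype.piFinset fun _ : Fin n => Finset.range (vol m + 1) := by
    intro φ _
    rw [Fintype.mem_piFinset]
    intro i
    rw [Finset.mem_range, Nat.lt_succ_iff, ← sum_colorCount φ]
    exact Finset.single_le_sum (fun _ _ => Nat.zero_le _) (Finset.mem_univ i)
  have key : partitionFn Γ m u ≤ ((vol m : ℝ) + 1) ^ n * Real.exp B := by
    calc partitionFn Γ m u
        = ∑ c ∈ Fintype.piFinset fun _ : Fin n => Finset.range (vol m + 1),
          ∑ φ ∈ boxColorings Γ m with colorCount φ = c,
            Real.exp (∑ i, (colorCount φ i : ℝ) * u i) :=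
          (Finset.sum_fiberwise_of_maps_to hmaps _).symm
      _ ≤ ∑ c ∈ Fintype.piFinset fun _ : Fin n => Finset.range (vol m + 1), Real.exp B := by
          refine Finset.sum_le_sum fun c _ => ?_
          have e : ((boxColorings Γ m).filter fun φ => colorCount φ = c) =
              boxColoringsWith Γ m c := by
            ext φ
            simp [mem_boxColoringsWith]
          rw [e]
          rcases (boxColoringsWith Γ m c).eq_empty_or_nonempty with h | h
          · rw [h, Finset.sum_empty]
            exact (Real.exp_pos _).le
          · have h0 : (0 : ℝ) < (boxColoringsWith Γ m c).card := by exact_mod_cast h.card_pos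
            rw [Finset.sum_congr rfl fun φ hφ => by rw [(mem_boxColoringsWith.1 hφ).2],
              Finset.sum_const, nsmul_eq_mul, ← Real.exp_log h0, ← Real.exp_add]
            exact Real.exp_le_exp.2 (by simpa [Real.exp_log h0] using hB c h)
      _ = _ := by
          rw [Finset.sum_const, Fintype.card_piFinset, nsmul_eq_mul]
          simp
  have hv : (0 : ℝ) < (vol m : ℝ) + 1 := by positivity
  calc Real.log (partitionFn Γ m u) ≤ Real.log (((vol m : ℝ) + 1) ^ n * Real.exp B) :=
        Real.log_le_log (partitionFn_pos hne u) key
    _ = _ := by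
        rw [Real.log_mul (by positivity) (Real.exp_ne_zero _), Real.log_pow, Real.log_exp]

/-- Lower bound by tiling a slightly larger box and restricting. -/
lemma le_log_partitionFn {Γ : Fin d → Digraph (Fin n)}
    {F : ∀ m : Fin d → ℕ+, Set (box m → Fin n)} (hF : IsFriendlyFamily Γ F)
    {x : (Fin n → ℝ) × ℝ} (hx : x ∈ finiteHypograph F) (u : Fin n → ℝ) :
    ∃ (w : Fin d → ℕ+) (K : ℝ), ∀ m : Fin d → ℕ+,
      (x.1 ⬝ᵥ u + x.2) - K * ((vol (m + w) : ℝ) / vol m - 1) ≤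
        Real.log (partitionFn Γ m u) / vol m := by
  obtain ⟨m₀, c₀, hne, hp, ht⟩ := hx
  set a := x.1 ⬝ᵥ u + x.2 with ha
  set U := ∑ i, |u i|
  have hn := Real.log_natCast_nonneg n
  have hU : 0 ≤ U := Finset.sum_nonneg fun _ _ => abs_nonneg _
  refine ⟨m₀, |a| + Real.log n + U, fun m => ?_⟩
  let q : Fin d → ℕ+ := fun k => Nat.succPNat ((m k : ℕ) / m₀ k)
  have hdiv : ∀ k, ((q * m₀) k : ℕ) = m₀ k * ((m k : ℕ) / m₀ k) + m₀ k := fun k => by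
    simp only [q, Pi.mul_apply, PNat.mul_coe, Nat.succPNat_coe, Nat.succ_eq_add_one]
    ring
  have h1 : m ≤ q * m₀ := fun k => by
    rw [← PNat.coe_le_coe, hdiv]
    have := Nat.div_add_mod (m k : ℕ) (m₀ k)
    have := Nat.mod_lt (m k : ℕ) (m₀ k).pos
    omega
  have h2 : q * m₀ ≤ m + m₀ := fun k => by
    rw [← PNat.coe_le_coe, hdiv, Pi.add_apply, PNat.add_coe]
    have := Nat.div_add_mod (m k : ℕ) (m₀ k)
    omega
  obtain ⟨hMne, hMlog⟩ := log_card_tile hF hne q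
  have hsub := membersWith_subset hF (q * m₀) (vol q • c₀)
  obtain ⟨c, g, hcg, hg, hcne, hcard⟩ := exists_card_le_of_restrict h1 (hMne.mono hsub)
  have hlog := log_card_le_of_card_le hMne.card_pos ((Finset.card_le_card hsub).trans hcard)
  have hZ := log_card_add_le_log_partitionFn hcne u
  have hgu := (abs_le.1 (abs_sum_mul_le g u)).2
  have hgr : (∑ i, (g i : ℝ)) = vol (q * m₀) - vol m := by
    rw [← Nat.cast_sub (vol_mono h1), ← hg]
    push_cast
    rfl
  have hcu : ∑ i, (c i : ℝ) * u i = vol q * (vol m₀ * (x.1 ⬝ᵥ u)) - ∑ i, (g i : ℝ) * u i := by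
    rw [hp, vol_mul_density_dotProduct, eq_sub_iff_add_eq, ← Finset.sum_add_distrib,
      Finset.mul_sum]
    refine Finset.sum_congr rfl fun i _ => ?_
    have := congrFun hcg i
    simp only [Pi.smul_apply, smul_eq_mul, Pi.add_apply] at this
    have : (vol q : ℝ) * c₀ i = c i + g i := by exact_mod_cast this
    rw [← add_mul, ← this]
    ring
  have hm := vol_pos_real m
  have hq := vol_pos_real q
  rw [le_div_iff₀ (vol_pos_real m₀)] at ht
  have ht' := mul_le_mul_of_nonneg_left ht hq.le
  have hv : (vol (q * m₀) : ℝ) = vol q * vol m₀ := by exact_mod_cast vol_mul q m₀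
  rw [Nat.cast_sub (vol_mono h1)] at hlog
  rw [hgr] at hgu
  have hD0 : (0 : ℝ) ≤ vol (q * m₀) - vol m := by
    rw [sub_nonneg]
    exact_mod_cast vol_mono h1
  have hD1 : (vol (q * m₀) : ℝ) ≤ vol (m + m₀) := by exact_mod_cast vol_mono h2
  have hfin : vol m * a - (|a| + Real.log n + U) * (vol (m + m₀) - vol m) ≤
      Real.log (partitionFn Γ m u) := by
    have s1 : (|a| + Real.log n + U) * ((vol (q * m₀) : ℝ) - vol m) ≤
        (|a| + Real.log n + U) * (vol (m + m₀) - vol m) :=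
      mul_le_mul_of_nonneg_left (by linarith) (by positivity)
    have s2 : -|a| * ((vol (q * m₀) : ℝ) - vol m) ≤ a * ((vol (q * m₀) : ℝ) - vol m) :=
      mul_le_mul_of_nonneg_right (neg_abs_le a) hD0
    have s3 : a * vol (q * m₀) = vol q * (vol m₀ * (x.1 ⬝ᵥ u)) + vol q * (x.2 * vol m₀) := by
      rw [hv, ha]
      ring
    change _ ≤ _ * U at hgu
    rw [hcu] at hZ
    linarith
  rw [le_div_iff₀ hm]
  calc _ = vol m * a - (|a| + Real.log n + U) * (vol (m + m₀) - vol m) := by field_simp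
    _ ≤ _ := hfin

/-- Upper bound by extending to members of the friendly family. -/
lemma log_partitionFn_le_of_friendly {Γ : Fin d → Digraph (Fin n)}
    {F : ∀ m : Fin d → ℕ+, Set (box m → Fin n)} {b : Fin d → ℕ+}
    (hb : ∀ (m : Fin d → ℕ+), ∀ α ∈ boxColorings Γ m,
      ∃ δ ∈ F (fun k => m k + 2 * b k),
        ∀ (x : box m) (y : box (fun k => m k + 2 * b k)),
          (y : Fin d → ℤ) = (x : Fin d → ℤ) + (fun k => ((b k : ℕ) : ℤ)) → δ y = α x)
    (hne : ∀ m, (boxColorings Γ m).Nonempty) {u : Fin n → ℝ} {σ : ℝ}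
    (hσ : ∀ x ∈ finiteHypograph F, x.1 ⬝ᵥ u + x.2 ≤ σ) (m : Fin d → ℕ+) :
    Real.log (partitionFn Γ m u) / vol m ≤ n * (Real.log (vol m + 1) / vol m) +
      (Real.log n + ∑ i, |u i|) * ((vol (m + 2 * b) : ℝ) / vol m - 1) +
      (vol (m + 2 * b) : ℝ) / vol m * σ := by
  have hm := vol_pos_real m
  have hle : vol m ≤ vol (m + 2 * b) := vol_mono fun k => by
    rw [← PNat.coe_le_coe, Pi.add_apply, PNat.add_coe]
    omega
  have key := log_partitionFn_le (hne m) (u := u)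
    (B := (Real.log n + ∑ i, |u i|) * (vol (m + 2 * b) - vol m) + vol (m + 2 * b) * σ) ?_
  · rw [div_le_iff₀ hm]
    refine key.trans (le_of_eq ?_)
    field_simp
    ring
  · intro c hc
    obtain ⟨g, hg, hFne, hcard⟩ := exists_card_le_of_extend hb hc
    have hlog := log_card_le_of_card_le hc.card_pos hcard
    rw [Nat.cast_sub hle] at hlog
    have hgr : (∑ i, (g i : ℝ)) = vol (m + 2 * b) - vol m := by
      rw [← Nat.cast_sub hle, ← hg]
      push_cast
      rfl
    have hgu := (abs_le.1 (abs_sum_mul_le g u)).1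
    rw [hgr] at hgu
    have hs := hσ (density (m + 2 * b) (c + g), _) ⟨m + 2 * b, c + g, hFne, rfl, le_rfl⟩
    have hv := vol_pos_real (m + 2 * b)
    have hs' := mul_le_mul_of_nonneg_left hs hv.le
    simp only at hs'
    rw [mul_add, vol_mul_density_dotProduct, mul_div_cancel₀ _ hv.ne'] at hs'
    simp only [Pi.add_apply, Nat.cast_add, add_mul, Finset.sum_add_distrib] at hs'
    linarith

/-! ### The pressure as a supremum -/

lemma tendsto_coord (k : Fin d) :
    Tendsto (fun m : Fin d → ℕ+ => (m k : ℕ)) atTop atTop :=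
  tendsto_atTop.2 fun N => (eventually_ge_atTop fun _ => N.succPNat).mono fun _ hm =>
    (Nat.le_succ N).trans (hm k)

lemma tendsto_atTop_of_coord {m : ℕ → Fin d → ℕ+}
    (h : ∀ k, Tendsto (fun q => (m q k : ℕ)) atTop atTop) : Tendsto m atTop atTop :=
  tendsto_atTop.2 fun w => (eventually_all.2 fun k => (h k).eventually_ge_atTop (w k)).mono
    fun _ hq k => hq k

lemma tendsto_vol_add_div (w : Fin d → ℕ+) :
    Tendsto (fun m : Fin d → ℕ+ => (vol (m + w) : ℝ) / vol m) atTop (𝓝 1) := by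
  have h : ∀ k : Fin d, Tendsto (fun m : Fin d → ℕ+ => (((m + w) k : ℕ) : ℝ) / (m k : ℕ)) atTop
      (𝓝 1) := by
    intro k
    have h1 : Tendsto (fun m : Fin d → ℕ+ => ((m k : ℕ) : ℝ)) atTop atTop :=
      tendsto_natCast_atTop_atTop.comp (tendsto_coord k)
    have h2 := (h1.const_div_atTop ((w k : ℕ) : ℝ)).const_add 1
    rw [add_zero] at h2
    refine h2.congr fun m => ?_
    have : ((m k : ℕ) : ℝ) ≠ 0 := by exact_mod_cast (m k).pos.ne'
    rw [Pi.add_apply, PNat.add_coe, Nat.cast_add, add_div, div_self this]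
  have h3 := tendsto_finsetProd (Finset.univ : Finset (Fin d)) fun k _ => h k
  rw [Finset.prod_const_one] at h3
  refine h3.congr fun m => ?_
  simp only [vol, Nat.cast_prod, Finset.prod_div_distrib]

lemma tendsto_vol (hd : 0 < d) : Tendsto (fun m : Fin d → ℕ+ => (vol m : ℝ)) atTop atTop := by
  refine tendsto_natCast_atTop_atTop.comp
    (tendsto_atTop_mono (fun m => ?_) (tendsto_coord ⟨0, hd⟩))
  exact Nat.le_of_dvd (vol_pos m) (Finset.dvd_prod_of_mem _ (Finset.mem_univ _))

lemma tendsto_log_vol_div (hd : 0 < d) :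
    Tendsto (fun m : Fin d → ℕ+ => Real.log (vol m + 1) / vol m) atTop (𝓝 0) := by
  have h1 : Tendsto (fun x : ℝ => Real.log (x + 1) / (x + 1) * ((x + 1) / x)) atTop (𝓝 0) := by
    have a := Real.isLittleO_log_id_atTop.tendsto_div_nhds_zero.comp
      (tendsto_atTop_add_const_right atTop (1 : ℝ) tendsto_id)
    have b : Tendsto (fun x : ℝ => (x + 1) / x) atTop (𝓝 1) := by
      have := (tendsto_id (α := ℝ)).const_div_atTop 1 |>.const_add 1
      rw [add_zero] at this
      refine this.congr' ((eventually_ne_atTop 0).mono fun x hx => ?_)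
      simp only [id]
      rw [add_div, div_self hx]
    simpa using a.mul b
  refine (h1.comp (tendsto_vol hd)).congr fun m => ?_
  have := vol_pos_real m
  simp only [Function.comp]
  field_simp

lemma abs_dotProduct_le {p : Fin n → ℝ} (hp : p ∈ stdSimplex ℝ (Fin n)) (u : Fin n → ℝ) :
    |p ⬝ᵥ u| ≤ ∑ i, |u i| := by
  refine (Finset.abs_sum_le_sum_abs _ _).trans (Finset.sum_le_sum fun i _ => ?_)
  rw [abs_mul, abs_of_nonneg (hp.1 i)]
  have : p i ≤ 1 := hp.2 ▸ Finset.single_le_sum (fun j _ => hp.1 j) (Finset.mem_univ i)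
  exact mul_le_of_le_one_left (abs_nonneg _) this

lemma boxColorings_nonempty {Γ : Fin d → Digraph (Fin n)} (hne : (latticeColorings Γ).Nonempty)
    (m : Fin d → ℕ+) : (boxColorings Γ m).Nonempty := by
  obtain ⟨φ, hφ⟩ := hne
  refine ⟨fun x => φ x, mem_boxColorings.2 fun k x y hxy => ?_⟩
  rw [hxy]
  exact hφ x k

/-- A friendly family together with a padding vector, as in the definition of a friendly `Γ`. -/
structure FriendlyExtension (Γ : Fin d → Digraph (Fin n))
    (F : ∀ m : Fin d → ℕ+, Set (box m → Fin n)) (b : Fin d → ℕ+) : Prop where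
  friendly : IsFriendlyFamily Γ F
  extend : ∀ (m : Fin d → ℕ+), ∀ α ∈ boxColorings Γ m,
    ∃ δ ∈ F (fun k => m k + 2 * b k),
      ∀ (x : box m) (y : box (fun k => m k + 2 * b k)),
        (y : Fin d → ℤ) = (x : Fin d → ℤ) + (fun k => ((b k : ℕ) : ℤ)) → δ y = α x

section

variable {Γ : Fin d → Digraph (Fin n)} {F : ∀ m : Fin d → ℕ+, Set (box m → Fin n)}
  {b : Fin d → ℕ+}

lemma finiteHypograph_nonempty (hne : (latticeColorings Γ).Nonempty)
    (hF : FriendlyExtension Γ F b) : (finiteHypograph F).Nonempty := by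
  obtain ⟨α, hα⟩ := boxColorings_nonempty hne 1
  obtain ⟨δ, hδ, -⟩ := hF.extend _ α hα
  exact ⟨(_, _), _, colorCount δ, ⟨δ, mem_membersWith.2 ⟨hδ, rfl⟩⟩, rfl, le_rfl⟩

lemma bddAbove_finiteHypograph (hF : FriendlyExtension Γ F b) (u : Fin n → ℝ) :
    BddAbove ((fun x : (Fin n → ℝ) × ℝ => x.1 ⬝ᵥ u + x.2) '' finiteHypograph F) := by
  refine ⟨(∑ i, |u i|) + Real.log n, ?_⟩
  rintro _ ⟨x, hx, rfl⟩
  exact add_le_add ((le_abs_self _).trans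
    (abs_dotProduct_le (finiteHypograph_fst_mem hF.friendly hx) u)) (finiteHypograph_snd_le hx)

lemma tendsto_log_partitionFn (hd : 0 < d) (hne : (latticeColorings Γ).Nonempty)
    (hF : FriendlyExtension Γ F b) {u : Fin n → ℝ} {σ : ℝ}
    (hσ : IsLUB ((fun x : (Fin n → ℝ) × ℝ => x.1 ⬝ᵥ u + x.2) '' finiteHypograph F) σ) :
    Tendsto (fun m : Fin d → ℕ+ => Real.log (partitionFn Γ m u) / (vol m : ℝ)) atTop (𝓝 σ) := by
  refine tendsto_order.2 ⟨fun a ha => ?_, fun a ha => ?_⟩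
  · obtain ⟨_, ⟨x, hx, rfl⟩, hax, -⟩ := hσ.exists_between ha
    obtain ⟨w, K, hK⟩ := le_log_partitionFn hF.friendly hx u
    have h : Tendsto (fun m : Fin d → ℕ+ =>
        (x.1 ⬝ᵥ u + x.2) - K * ((vol (m + w) : ℝ) / vol m - 1)) atTop (𝓝 (x.1 ⬝ᵥ u + x.2)) := by
      simpa using (((tendsto_vol_add_div w).sub_const 1).const_mul K).const_sub (x.1 ⬝ᵥ u + x.2)
    filter_upwards [h.eventually_const_lt hax] with m hm
    exact hm.trans_le (hK m)
  · have h : Tendsto (fun m : Fin d → ℕ+ => n * (Real.log (vol m + 1) / vol m) +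
        (Real.log n + ∑ i, |u i|) * ((vol (m + 2 * b) : ℝ) / vol m - 1) +
        (vol (m + 2 * b) : ℝ) / vol m * σ) atTop (𝓝 σ) := by
      have h1 := tendsto_vol_add_div (2 * b)
      have h2 := (((tendsto_log_vol_div hd).const_mul (n : ℝ)).add
        ((h1.sub_const 1).const_mul (Real.log n + ∑ i, |u i|))).add (h1.mul_const σ)
      simpa using h2
    filter_upwards [h.eventually_lt_const ha] with m hm
    exact (log_partitionFn_le_of_friendly hF.extend (boxColorings_nonempty hne)
      (fun x hx => hσ.1 ⟨x, hx, rfl⟩) m).trans_lt hm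

lemma isLUB_pressure (hd : 0 < d) (hne : (latticeColorings Γ).Nonempty)
    (hF : FriendlyExtension Γ F b) (u : Fin n → ℝ) :
    IsLUB ((fun x : (Fin n → ℝ) × ℝ => x.1 ⬝ᵥ u + x.2) '' finiteHypograph F) (pressure Γ u) := by
  have h := isLUB_csSup ((finiteHypograph_nonempty hne hF).image _)
    (bddAbove_finiteHypograph hF u)
  rwa [pressure, (tendsto_log_partitionFn hd hne hF h).limUnder_eq]

/-! ### The closed hypograph of the density entropy -/

lemma entropy_limsup_bounds {m : ℕ → Fin d → ℕ+} (A : ∀ q, Finset (box (m q) → Fin n)) :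
    IsBoundedUnder (· ≤ ·) atTop (fun q => Real.log ((A q).card : ℝ) / (vol (m q) : ℝ)) ∧
      IsCoboundedUnder (· ≤ ·) atTop
        (fun q => Real.log ((A q).card : ℝ) / (vol (m q) : ℝ)) :=
  ⟨isBoundedUnder_of ⟨Real.log n, fun q => log_card_div_vol_le (A q)⟩,
    (isBoundedUnder_of ⟨0, fun q => log_card_div_vol_nonneg (A q)⟩ :
      IsBoundedUnder (· ≥ ·) atTop _).isCoboundedUnder_le⟩

lemma bddAbove_densityEntropy (p : Fin n → ℝ) :
    BddAbove {s : ℝ | ∃ m c, Realizes Γ p m c ∧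
      s = limsup (fun q => Real.log ((boxColoringsWith Γ (m q) (c q)).card : ℝ) /
        (vol (m q) : ℝ)) atTop} := by
  refine ⟨Real.log n, ?_⟩
  rintro _ ⟨m, c, -, rfl⟩
  exact limsup_le_of_le (entropy_limsup_bounds _).2
    (Eventually.of_forall fun q => log_card_div_vol_le _)

lemma le_snd_mem_closure {x : (Fin n → ℝ) × ℝ} (hx : x ∈ closure (finiteHypograph F)) {t : ℝ}
    (ht : t ≤ x.2) : (x.1, t) ∈ closure (finiteHypograph F) := by
  have hmaps : Set.MapsTo (fun y : (Fin n → ℝ) × ℝ => (y.1, y.2 + (t - x.2)))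
      (finiteHypograph F) (finiteHypograph F) := by
    rintro y ⟨m, c, h1, h2, h3⟩
    exact ⟨m, c, h1, h2, by simp only; linarith⟩
  have := hmaps.closure (by fun_prop) hx
  simpa using this

/-- The limit points of the densities and entropies of allowed colorings are those of the members
of the friendly family: padding a box changes densities and entropies per site by a vanishing
amount. -/
lemma mem_closure_of_realizes (hF : FriendlyExtension Γ F b) {p : Fin n → ℝ}
    {m : ℕ → Fin d → ℕ+} {c : ℕ → Fin n → ℕ} (h : Realizes Γ p m c) :
    (p, limsup (fun q => Real.log ((boxColoringsWith Γ (m q) (c q)).card : ℝ) /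
      (vol (m q) : ℝ)) atTop) ∈ closure (finiteHypograph F) := by
  obtain ⟨hbd, hcobd⟩ := entropy_limsup_bounds fun q => boxColoringsWith Γ (m q) (c q)
  obtain ⟨r, hr1, hr2⟩ := exists_seq_tendsto_limsup hcobd hbd
  choose g hg hgne hgcard using fun q => exists_card_le_of_extend hF.extend (h.nonempty q)
  have hm := tendsto_atTop_of_coord h.tendsto_box
  let ρ : ℕ → ℝ := fun q => (vol (m q + 2 * b) : ℝ) / vol (m q)
  have hρ : Tendsto ρ atTop (𝓝 1) := (tendsto_vol_add_div (2 * b)).comp hm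
  have hle : ∀ q, vol (m q) ≤ vol (m q + 2 * b) := fun q => vol_mono fun k => by
    rw [← PNat.coe_le_coe, Pi.add_apply, PNat.add_coe]
    omega
  have hgi : ∀ i, Tendsto (fun q => (g q i : ℝ) / vol (m q)) atTop (𝓝 0) := by
    intro i
    refine squeeze_zero (g := fun q => ρ q - 1) (fun q => by positivity) (fun q => ?_)
      (by simpa using hρ.sub_const 1)
    have hv := vol_pos_real (m q)
    have h1 : (g q i : ℝ) ≤ (vol (m q + 2 * b) : ℝ) - vol (m q) := by
      rw [← Nat.cast_sub (hle q), ← hg q]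
      exact_mod_cast Finset.single_le_sum (fun _ _ => Nat.zero_le _) (Finset.mem_univ i)
    simp only [ρ]
    rw [div_sub_one hv.ne']
    exact div_le_div_of_nonneg_right h1 hv.le
  let y : ℕ → (Fin n → ℝ) × ℝ := fun q => (density (m q + 2 * b) (c q + g q),
    (Real.log ((boxColoringsWith Γ (m q) (c q)).card : ℝ) / vol (m q) -
      (ρ q - 1) * Real.log n) / ρ q)
  have hy1 : Tendsto (fun q => (y q).1) atTop (𝓝 p) := by
    rw [tendsto_pi_nhds]
    intro i
    have h1 := ((tendsto_pi_nhds.1 h.tendsto_density i).add (hgi i)).div hρ one_ne_zero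
    rw [add_zero, div_one] at h1
    refine h1.congr fun q => ?_
    have hv := vol_pos_real (m q)
    have hv' := vol_pos_real (m q + 2 * b)
    simp only [y, ρ, density, Pi.add_apply, Pi.div_apply, Nat.cast_add]
    field_simp
  have hρr := hρ.comp hr2
  have hy2 := ((hr1.sub ((hρr.sub_const 1).mul_const (Real.log n))).div hρr one_ne_zero)
  rw [sub_self, zero_mul, sub_zero, div_one] at hy2
  refine mem_closure_of_tendsto ((hy1.comp hr2).prodMk_nhds hy2) (Eventually.of_forall fun j => ?_)
  refine ⟨_, _, hgne (r j), rfl, ?_⟩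
  have hv := vol_pos_real (m (r j))
  have hv' := vol_pos_real (m (r j) + 2 * b)
  have hlog := log_card_le_of_card_le (h.nonempty (r j)).card_pos (hgcard (r j))
  rw [Nat.cast_sub (hle _)] at hlog
  simp only [Function.comp, ρ, Pi.div_apply]
  rw [div_le_div_iff₀ (by positivity) hv', ← mul_div_assoc, le_div_iff₀ hv]
  have e : (Real.log ((boxColoringsWith Γ (m (r j)) (c (r j))).card : ℝ) / vol (m (r j)) -
      ((vol (m (r j) + 2 * b) : ℝ) / vol (m (r j)) - 1) * Real.log n) *
      (vol (m (r j) + 2 * b) : ℝ) * vol (m (r j)) =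
      (Real.log ((boxColoringsWith Γ (m (r j)) (c (r j))).card : ℝ) -
      ((vol (m (r j) + 2 * b) : ℝ) - vol (m (r j))) * Real.log n) *
      (vol (m (r j) + 2 * b) : ℝ) := by
    field_simp
  rw [e]
  exact mul_le_mul_of_nonneg_right (by linarith) hv'.le

/-- Conversely, tiling ever larger boxes realizes every limit point. -/
lemma exists_realizes_of_mem_closure (hF : FriendlyExtension Γ F b) {x : (Fin n → ℝ) × ℝ}
    (hx : x ∈ closure (finiteHypograph F)) :
    ∃ m c, Realizes Γ x.1 m c ∧
      x.2 ≤ limsup (fun q => Real.log ((boxColoringsWith Γ (m q) (c q)).card : ℝ) /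
        (vol (m q) : ℝ)) atTop := by
  obtain ⟨y, hy, hlim⟩ := mem_closure_iff_seq_limit.1 hx
  choose m c hne hp ht using hy
  let r : ℕ → Fin d → ℕ+ := fun j _ => j.succPNat
  have hne' : ∀ j, (boxColoringsWith Γ (r j * m j) (vol (r j) • c j)).Nonempty := fun j =>
    (log_card_tile hF.friendly (hne j) (r j)).1.mono (membersWith_subset hF.friendly _ _)
  refine ⟨fun j => r j * m j, fun j => vol (r j) • c j,
    ⟨fun j => sum_eq_vol_of_mem (hne' j), fun k => ?_, hne', ?_⟩, ?_⟩
  · refine tendsto_atTop_mono (fun j => ?_) tendsto_id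
    calc id j ≤ (j + 1) * 1 := by simp
      _ ≤ (j + 1) * (m j k : ℕ) := Nat.mul_le_mul_left _ (m j k).pos
      _ = _ := rfl
  · have h1 : Tendsto (fun j => (y j).1) atTop (𝓝 x.1) := (continuous_fst.tendsto x).comp hlim
    refine h1.congr fun j => ?_
    rw [hp, ← density_smul (m j) (r j)]
    rfl
  · have h2 : Tendsto (fun j => (y j).2) atTop (𝓝 x.2) := (continuous_snd.tendsto x).comp hlim
    rw [← h2.limsup_eq]
    refine limsup_le_limsup (Eventually.of_forall fun j => ?_) h2.isCoboundedUnder_le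
      (entropy_limsup_bounds _).1
    refine ((ht j).trans (log_card_tile_div hF.friendly (hne j) (r j))).trans ?_
    refine div_le_div_of_nonneg_right (Real.log_le_log ?_ ?_) (vol_pos_real _).le
    · exact_mod_cast (log_card_tile hF.friendly (hne j) (r j)).1.card_pos
    · exact_mod_cast Finset.card_le_card (membersWith_subset hF.friendly _ _)

lemma mem_closure_iff_le_densityEntropy (hF : FriendlyExtension Γ F b) {p : Fin n → ℝ} {t : ℝ} :
    (p, t) ∈ closure (finiteHypograph F) ↔ p ∈ densityPoints Γ ∧ t ≤ densityEntropy Γ p := by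
  constructor
  · intro h
    obtain ⟨m, c, hr, hle⟩ := exists_realizes_of_mem_closure hF h
    refine ⟨⟨?_, m, c, hr⟩, hle.trans (le_csSup (bddAbove_densityEntropy p) ⟨m, c, hr, rfl⟩)⟩
    exact (isClosed_stdSimplex ℝ (Fin n)).mem_of_tendsto hr.tendsto_density
      (Eventually.of_forall fun q => density_mem_stdSimplex (hr.sum_eq q))
  · rintro ⟨⟨-, m, c, hr⟩, ht⟩
    -- The supremum that defines the entropy is attained, as the vertical slices are closed.
    have hmem : (p, densityEntropy Γ p) ∈ closure (finiteHypograph F) := by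
      have hcl : IsClosed {s : ℝ | (p, s) ∈ closure (finiteHypograph F)} :=
        isClosed_closure.preimage (by fun_prop : Continuous fun s : ℝ => (p, s))
      refine closure_minimal ?_ hcl (csSup_mem_closure ⟨_, m, c, hr, rfl⟩
        (bddAbove_densityEntropy (Γ := Γ) p))
      rintro _ ⟨m', c', hr', rfl⟩
      exact mem_closure_of_realizes hF hr'
    exact le_snd_mem_closure hmem ht

lemma densityEntropy_nonneg {p : Fin n → ℝ} (hp : p ∈ densityPoints Γ) :
    0 ≤ densityEntropy Γ p := by
  obtain ⟨-, m, c, hr⟩ := hp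
  refine le_trans ?_ (le_csSup (bddAbove_densityEntropy p) ⟨m, c, hr, rfl⟩)
  exact le_limsup_of_frequently_le
    (Eventually.of_forall fun q => log_card_div_vol_nonneg _).frequently
    (entropy_limsup_bounds _).1

end

/-- A closed set that contains the midpoints of its points is convex: a point of a segment that is
not in the set lies in a largest open gap, but the midpoint of the gap is in the set. -/
lemma convex_of_isClosed_of_midpoint {E : Type*} [AddCommGroup E] [Module ℝ E]
    [TopologicalSpace E] [ContinuousAdd E] [ContinuousSMul ℝ E] {s : Set E}
    (hs : IsClosed s) (hmid : ∀ x ∈ s, ∀ y ∈ s, (1 / 2 : ℝ) • (x + y) ∈ s) : Convex ℝ s := by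
  rw [convex_iff_segment_subset]
  intro x hx y hy
  rw [segment_eq_image]
  rintro _ ⟨t, ht, rfl⟩
  let f : ℝ → E := fun t => (1 - t) • x + t • y
  have hf : Continuous f := by fun_prop
  let T : Set ℝ := f ⁻¹' s
  have hT : IsClosed T := hs.preimage hf
  have hTmid : ∀ a ∈ T, ∀ b ∈ T, (a + b) / 2 ∈ T := by
    intro a ha b hb
    have h := hmid _ ha _ hb
    have e : f ((a + b) / 2) = (1 / 2 : ℝ) • (f a + f b) := by
      simp only [f]
      module
    change f _ ∈ s
    rwa [e]
  have h0 : (0 : ℝ) ∈ T := by simpa [T, f] using hx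
  have h1 : (1 : ℝ) ∈ T := by simpa [T, f] using hy
  by_contra hcon
  have htT : t ∉ T := hcon
  have hA : BddAbove (T ∩ Set.Iic t) := ⟨t, fun a ha => ha.2⟩
  have hB : BddBelow (T ∩ Set.Ici t) := ⟨t, fun a ha => ha.2⟩
  have ha := (hT.inter isClosed_Iic).csSup_mem ⟨0, h0, ht.1⟩ hA
  have hb := (hT.inter isClosed_Ici).csInf_mem ⟨1, h1, ht.2⟩ hB
  have hat : sSup (T ∩ Set.Iic t) < t := lt_of_le_of_ne ha.2 fun h => htT (h ▸ ha.1)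
  have htb : t < sInf (T ∩ Set.Ici t) := lt_of_le_of_ne hb.2 fun h => htT (h ▸ hb.1)
  have hm := hTmid _ ha.1 _ hb.1
  rcases le_total ((sSup (T ∩ Set.Iic t) + sInf (T ∩ Set.Ici t)) / 2) t with h | h
  · have := le_csSup hA ⟨hm, h⟩
    linarith
  · have := csInf_le hB ⟨hm, h⟩
    linarith

lemma convex_closure_finiteHypograph (hd : 0 < d) {Γ : Fin d → Digraph (Fin n)}
    {F : ∀ m : Fin d → ℕ+, Set (box m → Fin n)} (hF : IsFriendlyFamily Γ F) :
    Convex ℝ (closure (finiteHypograph F)) := by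
  refine convex_of_isClosed_of_midpoint isClosed_closure fun x hx y hy => ?_
  exact map_mem_closure₂ (f := fun x y : (Fin n → ℝ) × ℝ => (1 / 2 : ℝ) • (x + y)) (by fun_prop)
    hx hy fun _ ha _ hb => midpoint_mem_finiteHypograph hd hF ha hb

/-! ### Convex duality -/

section

variable {Γ : Fin d → Digraph (Fin n)} {F : ∀ m : Fin d → ℕ+, Set (box m → Fin n)}
  {b : Fin d → ℕ+}

lemma add_densityEntropy_le_pressure (hd : 0 < d) (hne : (latticeColorings Γ).Nonempty)
    (hF : FriendlyExtension Γ F b) {p : Fin n → ℝ} (hp : p ∈ densityPoints Γ) (u : Fin n → ℝ) :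
    p ⬝ᵥ u + densityEntropy Γ p ≤ pressure Γ u := by
  have hcl : IsClosed {x : (Fin n → ℝ) × ℝ | x.1 ⬝ᵥ u + x.2 ≤ pressure Γ u} :=
    isClosed_le ((continuous_fst.dotProduct continuous_const).add continuous_snd)
      continuous_const
  exact closure_minimal (fun x hx => (isLUB_pressure hd hne hF u).1 ⟨x, hx, rfl⟩) hcl
    ((mem_closure_iff_le_densityEntropy hF).2 ⟨hp, le_rfl⟩)

/-- A point outside the closed convex hypograph is separated from it by a hyperplane that is not
vertical, hence has a slope `u`. -/
lemma exists_pressure_lt (hd : 0 < d) (hne : (latticeColorings Γ).Nonempty)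
    (hF : FriendlyExtension Γ F b) {p : Fin n → ℝ} {t : ℝ}
    (h : (p, t) ∉ closure (finiteHypograph F)) : ∃ u, pressure Γ u < p ⬝ᵥ u + t := by
  obtain ⟨f, r, hfr, hr⟩ := geometric_hahn_banach_closed_point
    (convex_closure_finiteHypograph hd hF.friendly) isClosed_closure h
  let w : Fin n → ℝ := fun i => f (Pi.single i 1, 0)
  let β : ℝ := f (0, 1)
  have hf : ∀ y s, f (y, s) = y ⬝ᵥ w + s * β := by
    intro y s
    have e : ((y, s) : (Fin n → ℝ) × ℝ) =
        ∑ i, y i • ((Pi.single i 1, 0) : (Fin n → ℝ) × ℝ) + s • ((0, 1) : (Fin n → ℝ) × ℝ) := by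
      refine Prod.ext ?_ ?_
      · simpa [Prod.fst_sum] using pi_eq_sum_univ' y
      · simp [Prod.snd_sum]
    rw [e, map_add, map_sum, map_smul]
    simp only [map_smul, w, β, dotProduct, smul_eq_mul]
  -- The hypograph contains downward rays, hence the vertical coefficient is nonnegative.
  have hβ : 0 ≤ β := by
    by_contra! hneg
    obtain ⟨x, hx⟩ := finiteHypograph_nonempty hne hF
    have h1 := hfr _ (le_snd_mem_closure (subset_closure hx)
      (sub_le_self x.2 (abs_nonneg ((r - f x) / β))))
    have h2 : f x = x.1 ⬝ᵥ w + x.2 * β := hf x.1 x.2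
    rw [hf] at h1
    have h3 : (r - f x) / β * β = r - f x := div_mul_cancel₀ _ hneg.ne
    have h4 := mul_le_mul_of_nonpos_right (neg_abs_le ((r - f x) / β)) hneg.le
    have h5 := mul_le_mul_of_nonpos_right (le_abs_self ((r - f x) / β)) hneg.le
    nlinarith
  rw [hf] at hr
  -- A small increase `ε` of the vertical coefficient makes the hyperplane non-vertical. As entropies
  -- are at most `log n`, it still separates.
  obtain ⟨ε, hε, hεr⟩ : ∃ ε > 0, ε * (Real.log n - t) < p ⬝ᵥ w + t * β - r := by
    have hgap : 0 < p ⬝ᵥ w + t * β - r := by linarith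
    refine ⟨(p ⬝ᵥ w + t * β - r) / (|Real.log n - t| + 1), by positivity, ?_⟩
    rw [div_mul_eq_mul_div, div_lt_iff₀ (by positivity)]
    exact mul_lt_mul_of_pos_left ((le_abs_self _).trans_lt (lt_add_one _)) hgap
  have hpos : 0 < β + ε := by positivity
  refine ⟨(β + ε)⁻¹ • w, ?_⟩
  have hle : pressure Γ ((β + ε)⁻¹ • w) ≤ (r + ε * Real.log n) / (β + ε) := by
    refine (isLUB_pressure hd hne hF _).2 ?_
    rintro _ ⟨x, hx, rfl⟩
    have h1 := hfr _ (subset_closure hx)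
    have h2 : f x = x.1 ⬝ᵥ w + x.2 * β := hf x.1 x.2
    have h3 := mul_le_mul_of_nonneg_left (finiteHypograph_snd_le hx) hε.le
    rw [le_div_iff₀ hpos]
    simp only [dotProduct_smul, smul_eq_mul]
    rw [add_mul, mul_right_comm, inv_mul_cancel₀ hpos.ne', one_mul]
    linarith
  refine hle.trans_lt ?_
  rw [div_lt_iff₀ hpos, dotProduct_smul, smul_eq_mul, add_mul, mul_right_comm,
    inv_mul_cancel₀ hpos.ne', one_mul]
  linarith

lemma lt_conjugate (hd : 0 < d) (hne : (latticeColorings Γ).Nonempty)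
    (hF : FriendlyExtension Γ F b) {p : Fin n → ℝ} {t : ℝ}
    (h : (p, t) ∉ closure (finiteHypograph F)) :
    ((-t : ℝ) : EReal) < conjugate (pressure Γ) p := by
  obtain ⟨u, hu⟩ := exists_pressure_lt hd hne hF h
  refine lt_of_lt_of_le ?_ (le_iSup (fun x : Fin n → ℝ =>
    ((x ⬝ᵥ p - pressure Γ x : ℝ) : EReal)) u)
  rw [EReal.coe_lt_coe_iff, dotProduct_comm]
  linarith

lemma conjugate_pressure (hd : 0 < d) (hne : (latticeColorings Γ).Nonempty)
    (hF : FriendlyExtension Γ F b) {p : Fin n → ℝ} (hp : p ∈ densityPoints Γ) :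
    conjugate (pressure Γ) p = ((-densityEntropy Γ p : ℝ) : EReal) := by
  refine le_antisymm (iSup_le fun u => ?_) (le_of_forall_lt fun a ha => ?_)
  · have := add_densityEntropy_le_pressure hd hne hF hp u
    rw [EReal.coe_le_coe_iff, dotProduct_comm]
    linarith
  · obtain ⟨s, has, hs⟩ := EReal.lt_iff_exists_real_btwn.1 ha
    rw [EReal.coe_lt_coe_iff] at hs
    refine has.trans ?_
    have h : (p, -s) ∉ closure (finiteHypograph F) := fun hmem => by
      have := ((mem_closure_iff_le_densityEntropy hF).1 hmem).2
      linarith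
    simpa using lt_conjugate hd hne hF h

lemma densityPoints_eq_effectiveDomain (hd : 0 < d) (hne : (latticeColorings Γ).Nonempty)
    (hF : FriendlyExtension Γ F b) :
    densityPoints Γ = effectiveDomain (conjugate (pressure Γ)) := by
  ext p
  constructor
  · intro hp
    change conjugate (pressure Γ) p < ⊤
    rw [conjugate_pressure hd hne hF hp]
    exact EReal.coe_lt_top _
  · intro hp
    by_contra hcon
    refine (lt_irrefl _ ((show conjugate (pressure Γ) p < ⊤ from hp).trans_eq (Eq.symm ?_)))
    refine (EReal.eq_top_iff_forall_lt _).2 fun s => ?_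
    simpa using lt_conjugate hd hne hF (t := -s)
      fun h => hcon ((mem_closure_iff_le_densityEntropy hF).1 h).1

/-- Equality in the Fenchel inequality characterizes the subdifferential. -/
lemma mem_subdifferential_iff (hd : 0 < d) (hne : (latticeColorings Γ).Nonempty)
    (hF : FriendlyExtension Γ F b) {p u : Fin n → ℝ} :
    p ∈ subdifferential (pressure Γ) u ↔
      p ∈ densityPoints Γ ∧ p ⬝ᵥ u + densityEntropy Γ p = pressure Γ u := by
  constructor
  · intro h
    have hle : conjugate (pressure Γ) p ≤ ((p ⬝ᵥ u - pressure Γ u : ℝ) : EReal) := by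
      refine iSup_le fun z => ?_
      have := h z
      rw [dotProduct_sub] at this
      rw [EReal.coe_le_coe_iff, dotProduct_comm]
      linarith
    have hp : p ∈ densityPoints Γ := by
      rw [densityPoints_eq_effectiveDomain hd hne hF]
      exact hle.trans_lt (EReal.coe_lt_top _)
    rw [conjugate_pressure hd hne hF hp, EReal.coe_le_coe_iff] at hle
    exact ⟨hp, le_antisymm (add_densityEntropy_le_pressure hd hne hF hp u) (by linarith)⟩
  · rintro ⟨hp, he⟩ z
    have := add_densityEntropy_le_pressure hd hne hF hp z
    rw [dotProduct_sub]
    linarith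

lemma equilibriumDensities_eq_subdifferential (hd : 0 < d)
    (hne : (latticeColorings Γ).Nonempty) (hF : FriendlyExtension Γ F b) (u : Fin n → ℝ) :
    equilibriumDensities Γ u = subdifferential (pressure Γ) u := by
  ext p
  rw [mem_subdifferential_iff hd hne hF]
  refine and_congr_right fun hp => ⟨fun hmax => ?_, fun he p' hp' => ?_⟩
  · refine le_antisymm (add_densityEntropy_le_pressure hd hne hF hp u)
      ((isLUB_pressure hd hne hF u).2 ?_)
    rintro _ ⟨x, hx, rfl⟩
    obtain ⟨hx1, hx2⟩ := (mem_closure_iff_le_densityEntropy hF).1 (subset_closure hx)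
    have : x.1 ⬝ᵥ u + densityEntropy Γ x.1 ≤ p ⬝ᵥ u + densityEntropy Γ p := hmax hx1
    simp only
    linarith
  · exact (add_densityEntropy_le_pressure hd hne hF hp' u).trans_eq he.symm

lemma convex_densityPoints_and_concaveOn_densityEntropy (hd : 0 < d)
    (hF : FriendlyExtension Γ F b) :
    Convex ℝ (densityPoints Γ) ∧ ConcaveOn ℝ (densityPoints Γ) (densityEntropy Γ) := by
  have hK := convex_closure_finiteHypograph hd hF.friendly
  have key : ∀ p ∈ densityPoints Γ, ∀ p' ∈ densityPoints Γ, ∀ a a' : ℝ, 0 ≤ a → 0 ≤ a' →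
      a + a' = 1 → a • p + a' • p' ∈ densityPoints Γ ∧
        a • densityEntropy Γ p + a' • densityEntropy Γ p' ≤
          densityEntropy Γ (a • p + a' • p') := by
    intro p hp p' hp' a a' ha ha' haa
    exact (mem_closure_iff_le_densityEntropy hF).1
      (hK ((mem_closure_iff_le_densityEntropy hF).2 ⟨hp, le_rfl⟩)
        ((mem_closure_iff_le_densityEntropy hF).2 ⟨hp', le_rfl⟩) ha ha' haa)
  have hconv : Convex ℝ (densityPoints Γ) := fun p hp p' hp' a a' ha ha' haa =>
    (key p hp p' hp' a a' ha ha' haa).1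
  exact ⟨hconv, hconv, fun p hp p' hp' a a' ha ha' haa => (key p hp p' hp' a a' ha ha' haa).2⟩

end

end NNSOFT

theorem theorem4p7 {d n : ℕ} (hd : 0 < d) (Γ : Fin d → Digraph (Fin n))
    (hne : (NNSOFT.latticeColorings Γ).Nonempty) (hΓ : NNSOFT.IsFriendly Γ) :
    -- the limit that defines the pressure exists
    (∀ u : Fin n → ℝ, Tendsto
      (fun m : Fin d → ℕ+ => Real.log (NNSOFT.partitionFn Γ m u) / (NNSOFT.vol m : ℝ))
      atTop (𝓝 (NNSOFT.pressure Γ u))) ∧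
    -- (a)
    (Convex ℝ (NNSOFT.densityPoints Γ) ∧
      NNSOFT.densityPoints Γ =
        NNSOFT.effectiveDomain (NNSOFT.conjugate (NNSOFT.pressure Γ))) ∧
    -- (b)
    ((∀ p ∈ NNSOFT.densityPoints Γ, 0 ≤ NNSOFT.densityEntropy Γ p) ∧
      ConcaveOn ℝ (NNSOFT.densityPoints Γ) (NNSOFT.densityEntropy Γ)) ∧
    -- (c)
    (∀ u : Fin n → ℝ, NNSOFT.equilibriumDensities Γ u =
      NNSOFT.subdifferential (NNSOFT.pressure Γ) u) ∧
    -- (d)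
    (∀ u : Fin n → ℝ, ∃ g : (Fin n → ℝ) →ᵃ[ℝ] ℝ,
      Set.EqOn (NNSOFT.densityEntropy Γ) g (NNSOFT.subdifferential (NNSOFT.pressure Γ) u)) ∧
    -- (e)
    (∀ p ∈ NNSOFT.densityPoints Γ,
      ((NNSOFT.densityEntropy Γ p : ℝ) : EReal) = - NNSOFT.conjugate (NNSOFT.pressure Γ) p) := by
  obtain ⟨F, hF, b, hb⟩ := hΓ
  have hE : NNSOFT.FriendlyExtension Γ F b := ⟨hF, hb⟩
  obtain ⟨hconv, hconc⟩ := NNSOFT.convex_densityPoints_and_concaveOn_densityEntropy hd hE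
  refine ⟨fun u => NNSOFT.tendsto_log_partitionFn hd hne hE (NNSOFT.isLUB_pressure hd hne hE u),
    ⟨hconv, NNSOFT.densityPoints_eq_effectiveDomain hd hne hE⟩,
    ⟨fun p hp => NNSOFT.densityEntropy_nonneg hp, hconc⟩,
    NNSOFT.equilibriumDensities_eq_subdifferential hd hne hE, fun u => ?_, fun p hp => ?_⟩
  · refine ⟨AffineMap.const ℝ _ (NNSOFT.pressure Γ u) -
      (dotProductBilin ℝ ℝ u).toAffineMap, fun p hp => ?_⟩
    have h := ((NNSOFT.mem_subdifferential_iff hd hne hE).1 hp).2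
    rw [dotProduct_comm] at h
    change _ = NNSOFT.pressure Γ u - u ⬝ᵥ p
    linarith
  · rw [NNSOFT.conjugate_pressure hd hne hE hp, EReal.coe_neg, neg_neg]
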